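/- Let $X$ be a connected compact complex manifold of dimension $n$, let $p\in\{1,\dots,n-1\}$, and let $E\subset T^{1,0}X$ be a $C^\infty$ complex vector subbundle of rank $\ge p$. For a $(1,1)$-form $\gamma$ and $q\ge 1$ put $\gamma_q:=\gamma^q/q!$. Assume that $X$ is partially $p$-Kähler hyperbolic in the $E$-directions, that is, there exist positive semi-definite $C^\infty$ $(1,1)$-forms $\omega_E,\omega_{nE}$ on $X$ such that: (i) $\omega:=\omega_E+\omega_{nE}$ is positive definite on $X$; (ii) $\omega_E(x)(\xi,\bar\xi)>0$ for all $x\in X$ and all $\xi\in E_x\setminus\{0\}$; (iii) $\omega_{nE}(x)(\xi,\bar\eta)=0$ for all $x\in X$ and all $\xi,\eta\in E_x$; (iv) $\Omega:=\omega_E^p/p!$ is $d$-closed and $\tilde d$(bounded) on $(X,\omega)$: if $\pi:\widetilde X\to X$ is the universal cover, then $\pi^\star\Omega=d\widetilde\Gamma$ for some $C^\infty$ $(2p-1)$-form $\widetilde\Gamma$ on $\widetilde X$ that is bounded with respect to $\pi^\star\omega$. Then $X$ is partially $p$-hyperbolic in the $E$-directions, that is, there is no holomorphic map $f:\mathbb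 C^p\to X$ with all of the following properties: (1) $f$ is $E$-horizontal: the image of $d_zf$ is contained in $E_{f(z)}$ for every $z\in\mathbb C^p$; (2) $f$ is non-degenerate at some point $x_0\in\mathbb C^p$, i.e. $d_{x_0}f$ has rank $p$; (3) $f$ has subexponential growth with respect to some (equivalently, any) Hermitian metric $\gamma$ on $X$. This means the following. Let $B_t,S_t\subset\mathbb C^p$ be the open ball and the sphere of radius $t$ centred at $0$, let $\tau(z)=|z|^2$, and let $\mathrm{Vol}_{\gamma,f}(B_t)=\int_{B_t}f^\star\gamma_p$. Off the degeneracy set of $f$ (which is negligible in the spheres) let $d\sigma_{\gamma,f}=\star_{f^\star\gamma}\big(d\tau/|d\tau|_{f^\star\gamma}\big)$, and let $d\sigma_{\gamma,f,t}$ be its restriction to $S_t$. Then there are constants $C_1,r_0>0$ with $$\int_{S_t}|d\tau|_{f^\star\gamma}\,d\sigma_{\gamma,f,t}\le C_1\,t\,\mathrm{Vol}_{\gamma,f}(B_t)\qquad\text{for all }t>r_0,$$ and for every constant $C>0$ $$\limsup_{b\to+\infty}\Big(\frac bC-\log\int_0^b\mathrm{Vol}_{\gamma,f}(B_t)\,dt\Big)=+\infty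 .$$ -/

import Mathlib

open Set Filter Topology MeasureTheory
open scoped Manifold ContDiff

universe u

/-!
A complex manifold is a space `X` charted on a complex normed space `V` with
`IsManifold 𝓘(ℂ, V) ω X` (complex analytic coordinate changes).  The complex vector space
`TangentSpace 𝓘(ℂ, V) x` is the holomorphic tangent space `T^{1,0}_x X`, identified with the real
tangent space at `x` via `ξ ↦ 2 Re ξ`; multiplication by `Complex.I` is the complex structure `J`.
-/

noncomputable section

namespace PartialHyp

/-! ### Differential forms on complex manifolds -/

/-- Real-valued `k`-forms, not necessarily continuous: at each `x`, an `ℝ`-multilinear alternating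
map on the tangent space at `x`. (In Mathlib `TangentSpace 𝓘(ℂ, V) x` is by definition `V`,
identified with the tangent space through the preferred chart at `x`.) -/
abbrev DiffForm (V : Type*) [NormedAddCommGroup V] [NormedSpace ℂ V] (X : Type*) (k : ℕ) : Type _ :=
  X → V [⋀^Fin k]→L[ℝ] ℝ

/-- The differential of a map between complex manifolds. -/
def diff {W : Type*} [NormedAddCommGroup W] [NormedSpace ℂ W]
    {V : Type*} [NormedAddCommGroup V] [NormedSpace ℂ V]
    {N : Type*} [TopologicalSpace N] [ChartedSpace W N]
    {X : Type*} [TopologicalSpace X] [ChartedSpace V X] (f : N → X) (z : N) : W →L[ℂ] V :=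
  mfderiv 𝓘(ℂ, W) 𝓘(ℂ, V) f z

/-- The pullback `f^* α` of a form under a (holomorphic) map. -/
def pullback {W : Type*} [NormedAddCommGroup W] [NormedSpace ℂ W]
    {V : Type*} [NormedAddCommGroup V] [NormedSpace ℂ V]
    {N : Type*} [TopologicalSpace N] [ChartedSpace W N]
    {X : Type*} [TopologicalSpace X] [ChartedSpace V X] {k : ℕ}
    (f : N → X) (α : DiffForm V X k) : DiffForm W N k :=
  fun z => (α (f z)).compContinuousLinearMap ((diff f z : W →L[ℂ] V).restrictScalars ℝ)

/-- The form `α` is `C^∞` (in the real sense): so is its expression in every chart. -/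
def IsSmoothForm {V : Type*} [NormedAddCommGroup V] [NormedSpace ℂ V]
    {X : Type*} [TopologicalSpace X] [ChartedSpace V X] {k : ℕ} (α : DiffForm V X k) : Prop :=
  ∀ φ ∈ atlas V X, ContDiffOn ℝ ∞ (pullback (W := V) φ.symm α) φ.target

/-- The exterior derivative, computed at `x` in the preferred chart at `x`. -/
def extD {V : Type*} [NormedAddCommGroup V] [NormedSpace ℂ V]
    {X : Type*} [TopologicalSpace X] [ChartedSpace V X] {k : ℕ} (α : DiffForm V X k) :
    DiffForm V X (k + 1) :=
  fun x => (extDeriv (pullback (W := V) (chartAt V x).symm α)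
    (chartAt V x x)).compContinuousLinearMap
      ((diff (chartAt V x) x : V →L[ℂ] V).restrictScalars ℝ)

/-! ### `(1,1)`-forms and their powers -/

/-- A real `2`-form is of type `(1,1)` iff it is invariant under the complex structure. -/
def IsOneOne {V : Type*} [NormedAddCommGroup V] [NormedSpace ℂ V] {X : Type*}
    (γ : DiffForm V X 2) : Prop :=
  ∀ x (u v : V), γ x ![Complex.I • u, Complex.I • v] = γ x ![u, v]

/-- The squared length of `u` for the (semi-)metric of a real `(1,1)`-form; up to a positive
constant, the value on `(ξ, ξ̄)` for the `(1,0)`-vector `ξ` with real part `u`. -/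
def quad {V : Type*} [NormedAddCommGroup V] [NormedSpace ℂ V]
    (a : V [⋀^Fin 2]→L[ℝ] ℝ) (u : V) : ℝ :=
  a ![u, Complex.I • u]

/-- The Hermitian form `(ξ, η) ↦ γ(ξ, η̄)` (up to a nonzero constant) of a real `(1,1)`-form. -/
def herm {V : Type*} [NormedAddCommGroup V] [NormedSpace ℂ V]
    (a : V [⋀^Fin 2]→L[ℝ] ℝ) (u v : V) : ℂ :=
  (a ![u, Complex.I • v] : ℂ) - Complex.I * (a ![u, v] : ℂ)

/-- A `C^∞` real `(1,1)`-form that is positive semi-definite. -/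
structure IsSemipositive {V : Type*} [NormedAddCommGroup V] [NormedSpace ℂ V]
    {X : Type*} [TopologicalSpace X] [ChartedSpace V X] (γ : DiffForm V X 2) : Prop where
  smooth : IsSmoothForm γ
  oneOne : IsOneOne γ
  nonneg : ∀ x (u : V), 0 ≤ quad (γ x) u

/-- A Hermitian metric: a `C^∞` positive definite `(1,1)`-form. -/
structure IsHermitianMetric {V : Type*} [NormedAddCommGroup V] [NormedSpace ℂ V]
    {X : Type*} [TopologicalSpace X] [ChartedSpace V X] (γ : DiffForm V X 2) : Prop where
  smooth : IsSmoothForm γ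
  oneOne : IsOneOne γ
  pos : ∀ x (u : V), u ≠ 0 → 0 < quad (γ x) u

theorem pairProd_factor_of_ne {V : Type*} {p k : ℕ} (hk : k = 2 * p)
    [DecidableEq (Fin k)] (v : Fin k → V) (m : Fin k) (x : V) (i : Fin p) (hi : i.val ≠ m.val / 2) :
    (![Function.update v m x ⟨2 * i, by omega⟩, Function.update v m x ⟨2 * i + 1, by omega⟩] :
      Fin 2 → V) = ![v ⟨2 * i, by omega⟩, v ⟨2 * i + 1, by omega⟩] := by
  have h1 : (⟨2 * i, by omega⟩ : Fin k) ≠ m := by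
    intro h; apply hi; rw [← h]; simp
  have h2 : (⟨2 * i + 1, by omega⟩ : Fin k) ≠ m := by
    intro h; apply hi; rw [← h]; simp only; omega
  rw [Function.update_of_ne h1, Function.update_of_ne h2]

theorem pairProd_factor_of_eq {V : Type*} {p k : ℕ} (hk : k = 2 * p)
    [DecidableEq (Fin k)] (v : Fin k → V) (m : Fin k) (i : Fin p) (hi : i.val = m.val / 2) :
    ∃ (j : Fin 2) (w : Fin 2 → V), ∀ x : V,
      (![Function.update v m x ⟨2 * i, by omega⟩, Function.update v m x ⟨2 * i + 1, by omega⟩] :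
        Fin 2 → V) = Function.update w j x := by
  rcases Nat.mod_two_eq_zero_or_one m.val with h | h
  · have h1 : (⟨2 * i, by omega⟩ : Fin k) = m := Fin.ext (by simp only; omega)
    have h2 : (⟨2 * i + 1, by omega⟩ : Fin k) ≠ m := by
      intro h'; have := congrArg Fin.val h'; simp only at this; omega
    refine ⟨0, ![v m, v ⟨2 * i + 1, by omega⟩], fun x => ?_⟩
    rw [Function.update_of_ne h2, h1, Function.update_self]
    ext j; fin_cases j <;> rfl
  · have h1 : (⟨2 * i, by omega⟩ : Fin k) ≠ m := by
      intro h'; have := congrArg Fin.val h'; simp only at this; omega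
    have h2 : (⟨2 * i + 1, by omega⟩ : Fin k) = m := Fin.ext (by simp only; omega)
    refine ⟨1, ![v ⟨2 * i, by omega⟩, v m], fun x => ?_⟩
    rw [Function.update_of_ne h1, h2, Function.update_self]
    ext j; fin_cases j <;> rfl

/-- The `ℝ`-multilinear map `v ↦ ∏ i < p, a (v (2 i), v (2 i + 1))`. -/
def pairProd {V : Type*} [NormedAddCommGroup V] [NormedSpace ℂ V]
    (a : V [⋀^Fin 2]→L[ℝ] ℝ) (p k : ℕ) (hk : k = 2 * p) :
    ContinuousMultilinearMap ℝ (fun _ : Fin k => V) ℝ where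
  toFun v := ∏ i : Fin p, a ![v ⟨2 * i, by omega⟩, v ⟨2 * i + 1, by omega⟩]
  map_update_add' := by
    intro _ v m x y
    have hm : m.val / 2 < p := by omega
    obtain ⟨j, w, hw⟩ := pairProd_factor_of_eq hk v m ⟨m.val / 2, hm⟩ rfl
    have key : ∀ z : V, (∏ i : Fin p, a ![Function.update v m z ⟨2 * i, by omega⟩,
          Function.update v m z ⟨2 * i + 1, by omega⟩]) = a (Function.update w j z) *
        ∏ i ∈ Finset.univ.erase (⟨m.val / 2, hm⟩ : Fin p),
          a ![v ⟨2 * i, by omega⟩, v ⟨2 * i + 1, by omega⟩] := by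
      intro z
      rw [← Finset.mul_prod_erase Finset.univ _ (Finset.mem_univ (⟨m.val / 2, hm⟩ : Fin p)), hw z]
      congr 1
      refine Finset.prod_congr rfl fun i hi => ?_
      rw [pairProd_factor_of_ne hk v m z i fun h => Finset.ne_of_mem_erase hi (Fin.ext h)]
    rw [key, key, key, a.map_update_add, add_mul]
  map_update_smul' := by
    intro _ v m c x
    have hm : m.val / 2 < p := by omega
    obtain ⟨j, w, hw⟩ := pairProd_factor_of_eq hk v m ⟨m.val / 2, hm⟩ rfl
    have key : ∀ z : V, (∏ i : Fin p, a ![Function.update v m z ⟨2 * i, by omega⟩,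
          Function.update v m z ⟨2 * i + 1, by omega⟩]) = a (Function.update w j z) *
        ∏ i ∈ Finset.univ.erase (⟨m.val / 2, hm⟩ : Fin p),
          a ![v ⟨2 * i, by omega⟩, v ⟨2 * i + 1, by omega⟩] := by
      intro z
      rw [← Finset.mul_prod_erase Finset.univ _ (Finset.mem_univ (⟨m.val / 2, hm⟩ : Fin p)), hw z]
      congr 1
      refine Finset.prod_congr rfl fun i hi => ?_
      rw [pairProd_factor_of_ne hk v m z i fun h => Finset.ne_of_mem_erase hi (Fin.ext h)]
    rw [key, key, a.map_update_smul, smul_eq_mul, smul_eq_mul, mul_assoc]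
  cont := by
    refine continuous_finsetProd _ fun i _ => a.cont.comp (continuous_pi fun j => ?_)
    fin_cases j <;> exact continuous_apply _

/-- The divided power `a_p = a ∧ ⋯ ∧ a / p!` of a `2`-form, a form of degree `k = 2 p`:
`a_p (v) = (2 ^ p p!)⁻¹ ∑ σ, sign σ ∏ i, a (v (σ (2 i)), v (σ (2 i + 1)))`. -/
def divPow {V : Type*} [NormedAddCommGroup V] [NormedSpace ℂ V]
    (a : V [⋀^Fin 2]→L[ℝ] ℝ) (p k : ℕ) (hk : k = 2 * p) : V [⋀^Fin k]→L[ℝ] ℝ :=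
  ((2 : ℝ) ^ p * (p.factorial : ℝ))⁻¹ •
    ContinuousMultilinearMap.alternatization (pairProd a p k hk)

/-- The form `γ_p = γ^p / p!` on a manifold; its degree `2 p` is written as `(2 p - 1) + 1`. -/
def formPow {V : Type*} [NormedAddCommGroup V] [NormedSpace ℂ V] {X : Type*}
    (γ : DiffForm V X 2) (p : ℕ) (hp : 1 ≤ p) : DiffForm V X (2 * p - 1 + 1) :=
  fun x => divPow (γ x) p (2 * p - 1 + 1) (by omega)

/-! ### `d̃(bounded)` forms -/

/-- The form `β` is bounded with respect to the metric `γ`. -/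
def IsBoundedForm {V : Type*} [NormedAddCommGroup V] [NormedSpace ℂ V] {X : Type*} {k : ℕ}
    (γ : DiffForm V X 2) (β : DiffForm V X k) : Prop :=
  ∃ C : ℝ, ∀ x (v : Fin k → V), |β x v| ≤ C * ∏ i, Real.sqrt (quad (γ x) (v i))

/-- `α` is `d(bounded)` for the metric `γ`: it is `dβ` for a `C^∞` bounded form `β`. (For real
`α` one may take `β` real, passing to the real part.) -/
def IsDBounded {V : Type*} [NormedAddCommGroup V] [NormedSpace ℂ V]
    {X : Type*} [TopologicalSpace X] [ChartedSpace V X] {k : ℕ}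
    (γ : DiffForm V X 2) (α : DiffForm V X (k + 1)) : Prop :=
  ∃ β : DiffForm V X k, IsSmoothForm β ∧ IsBoundedForm γ β ∧ ∀ x, α x = extD β x

/-- `π : Y → X` is the universal covering map of the connected complex manifold `X`, with the
complex structure on `Y` for which `π` is locally biholomorphic. -/
structure IsUniversalCover (V : Type*) [NormedAddCommGroup V] [NormedSpace ℂ V]
    {Y : Type*} [TopologicalSpace Y] [ChartedSpace V Y]
    {X : Type*} [TopologicalSpace X] [ChartedSpace V X] (π : Y → X) : Prop where
  simplyConnected : SimplyConnectedSpace Y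
  covering : IsCoveringMap π
  localBiholomorphic : IsLocalDiffeomorph 𝓘(ℂ, V) 𝓘(ℂ, V) ω π

/-- `α` is `d̃(bounded)` for the metric `γ`: its lift to the universal cover is `d(bounded)` for the
lifted metric. (The universal cover is unique up to a biholomorphism over `X`.) -/
def IsTildeDBounded {V : Type*} [NormedAddCommGroup V] [NormedSpace ℂ V]
    {X : Type u} [TopologicalSpace X] [ChartedSpace V X] {k : ℕ}
    (γ : DiffForm V X 2) (α : DiffForm V X (k + 1)) : Prop :=
  ∃ (Y : Type u) (_ : TopologicalSpace Y) (_ : ChartedSpace V Y)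
    (_ : IsManifold 𝓘(ℂ, V) ω Y) (π : Y → X),
    IsUniversalCover V π ∧ IsDBounded (pullback π γ) (pullback π α : DiffForm V Y (k + 1))

/-! ### Subbundles and partial `p`-Kähler hyperbolicity -/

/-- A `C^∞` complex vector subbundle of rank `r` of `T^{1,0}X`: complex subspaces of the tangent
spaces which, near every point, are spanned by a `C^∞` complex frame `s₁, …, s_r` (written in the
preferred chart at that point). -/
structure SmoothSubbundle (V : Type*) [NormedAddCommGroup V] [NormedSpace ℂ V]
    (X : Type*) [TopologicalSpace X] [ChartedSpace V X] (r : ℕ) where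
  fiber : X → Submodule ℂ V
  exists_frame : ∀ x₀ : X, ∃ U : Set V, IsOpen U ∧ chartAt V x₀ x₀ ∈ U ∧
    U ⊆ (chartAt V x₀).target ∧ ∃ s : Fin r → V → V,
      (∀ i, ContDiffOn ℝ ∞ (s i) U) ∧
      ∀ y ∈ U, LinearIndependent ℂ (fun i => s i y) ∧
        fiber ((chartAt V x₀).symm y) =
          (Submodule.span ℂ (Set.range fun i => s i y)).map
            (diff (W := V) (V := V) (chartAt V x₀).symm y : V →ₗ[ℂ] V)

/-- `X` is partially `p`-Kähler hyperbolic in the directions of `E`. -/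
def IsPartiallyKahlerHyperbolic {V : Type*} [NormedAddCommGroup V] [NormedSpace ℂ V]
    {X : Type u} [TopologicalSpace X] [ChartedSpace V X] {r : ℕ}
    (E : SmoothSubbundle V X r) (p : ℕ) (hp : 1 ≤ p) : Prop :=
  ∃ γE γN : DiffForm V X 2, IsSemipositive γE ∧ IsSemipositive γN ∧
    IsHermitianMetric (γE + γN) ∧
    (∀ x, ∀ ξ ∈ E.fiber x, ξ ≠ 0 → 0 < quad (γE x) ξ) ∧
    (∀ x, ∀ ξ ∈ E.fiber x, ∀ η ∈ E.fiber x, herm (γN x) ξ η = 0) ∧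
    (∀ x, extD (formPow γE p hp) x = 0) ∧
    IsTildeDBounded (γE + γN) (formPow γE p hp)

/-! ### Volumes, areas and growth for maps `ℂ^q → X` -/

/-- The Hermitian space `ℂ^q`. -/
abbrev Cn (q : ℕ) : Type := EuclideanSpace ℂ (Fin q)

/-- The standard positively oriented real basis `e₁, i e₁, e₂, i e₂, …` of `ℂ^q` (`q ≥ 1`). -/
def stdFrame (q : ℕ) : Fin (2 * q - 1 + 1) → Cn q := fun j =>
  if h : j.val / 2 < q then EuclideanSpace.single ⟨j.val / 2, h⟩ (Complex.I ^ (j.val % 2)) else 0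

/-- The integral of a form of top degree over the ball `B_r ⊆ ℂ^q`. -/
def ballIntegral {q : ℕ} (r : ℝ) (β : DiffForm (Cn q) (Cn q) (2 * q - 1 + 1)) : ℝ :=
  ∫ z in Metric.ball (0 : Cn q) r, β z (stdFrame q)

/-- The exterior product of a covector and a `k`-form. -/
def covecWedge {V : Type*} [NormedAddCommGroup V] [NormedSpace ℂ V] {k : ℕ}
    (θ : V →L[ℝ] ℝ) (b : V [⋀^Fin k]→L[ℝ] ℝ) : V [⋀^Fin (k + 1)]→L[ℝ] ℝ :=
  .alternatizeUncurryFin (θ.smulRight b)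

/-- The differential at `z` of the distance `r = |z|` to the origin (for `z ≠ 0`). -/
def dr {V : Type*} [NormedAddCommGroup V] [NormedSpace ℂ V] (z : V) : V →L[ℝ] ℝ :=
  fderiv ℝ (fun w : V => ‖w‖) z

/-- The differential at `z` of `τ(z) = |z|²`. -/
def dtau {V : Type*} [NormedAddCommGroup V] [NormedSpace ℂ V] (z : V) : V →L[ℝ] ℝ :=
  fderiv ℝ (fun w : V => ‖w‖ ^ 2) z

/-- The integral of a `(2q-1)`-form over the sphere `S_t ⊆ ℂ^q`, oriented as the boundary of the
ball. Its restriction to `S_t` is `c` times the Euclidean area measure, where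
`dr ∧ β = c · (Euclidean volume form)`, `dr` being dual to the outward unit normal; the
Euclidean area measure of `S_t` is `t ^ (2q-1)` times that of the unit sphere. -/
def sphereIntegral {q : ℕ} (t : ℝ) (β : DiffForm (Cn q) (Cn q) (2 * q - 1)) : ℝ :=
  t ^ (2 * q - 1) * ∫ u : Metric.sphere (0 : Cn q) 1,
    covecWedge (dr (t • (u : Cn q))) (β (t • (u : Cn q))) (stdFrame q)
      ∂(volume : Measure (Cn q)).toSphere

open Classical in
/-- The vector `θ^♯` dual to the covector `θ` for the Riemannian metric `(u, v) ↦ a (u, J v)` of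
the `(1,1)`-form `a`, determined by `a (θ^♯, J v) = θ v`. It is meant for positive definite `a`. -/
def sharp {V : Type*} [NormedAddCommGroup V] [NormedSpace ℂ V]
    (a : V [⋀^Fin 2]→L[ℝ] ℝ) (θ : V →L[ℝ] ℝ) : V :=
  if h : ∃ w : V, ∀ v, a ![w, Complex.I • v] = θ v then h.choose else 0

/-- The length of a covector for the metric of `a`. -/
def covecNorm {V : Type*} [NormedAddCommGroup V] [NormedSpace ℂ V]
    (a : V [⋀^Fin 2]→L[ℝ] ℝ) (θ : V →L[ℝ] ℝ) : ℝ :=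
  Real.sqrt (quad a (sharp a θ))

/-- The Hodge star of a covector in complex dimension `q` for the metric of `a`: the contraction of the volume form
`a_q` with `θ^♯`, which satisfies `θ ∧ ⋆θ = |θ|² a_q`. It vanishes where `a` is degenerate, since
`a_q = 0` there. -/
def hodgeStar {V : Type*} [NormedAddCommGroup V] [NormedSpace ℂ V] {q : ℕ} (hq : 1 ≤ q)
    (a : V [⋀^Fin 2]→L[ℝ] ℝ) (θ : V →L[ℝ] ℝ) : V [⋀^Fin (2 * q - 1)]→L[ℝ] ℝ :=
  (divPow a q (2 * q - 1 + 1) (by omega)).curryLeft (sharp a θ)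

/-- The area form `dσ = ⋆(dτ / |dτ|)` of the degenerate metric `h` on `ℂ^q`. -/
def areaForm {q : ℕ} (hq : 1 ≤ q) (h : DiffForm (Cn q) (Cn q) 2) :
    DiffForm (Cn q) (Cn q) (2 * q - 1) :=
  fun z => hodgeStar hq (h z) ((covecNorm (h z) (dtau z))⁻¹ • dtau z)

/-- The `(γ, f)`-volume of the ball `B_r`, i.e. `∫_{B_r} f^* γ_q`. -/
def volBall {V : Type*} [NormedAddCommGroup V] [NormedSpace ℂ V]
    {X : Type*} [TopologicalSpace X] [ChartedSpace V X] {q : ℕ} (hq : 1 ≤ q)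
    (γ : DiffForm V X 2) (f : Cn q → X) (r : ℝ) : ℝ :=
  ballIntegral r (pullback f (formPow γ q hq))

/-- The integral `∫_{S_t} |dτ|_{f^*γ} dσ_{γ,f,t}`. The integrand vanishes on the degeneracy set
of `f`, which is negligible in `S_t` when `f` is nondegenerate somewhere. -/
def weightedArea {V : Type*} [NormedAddCommGroup V] [NormedSpace ℂ V]
    {X : Type*} [TopologicalSpace X] [ChartedSpace V X] {q : ℕ} (hq : 1 ≤ q)
    (γ : DiffForm V X 2) (f : Cn q → X) (t : ℝ) : ℝ :=
  sphereIntegral t fun z =>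
    covecNorm (pullback (W := Cn q) f γ z) (dtau z) • areaForm hq (pullback f γ) z

/-- Subexponential growth of `f : ℂ^q → X` with respect to the Hermitian metric `γ` on `X`. -/
structure HasSubexponentialGrowth {V : Type*} [NormedAddCommGroup V] [NormedSpace ℂ V]
    {X : Type*} [TopologicalSpace X] [ChartedSpace V X] {q : ℕ} (hq : 1 ≤ q)
    (γ : DiffForm V X 2) (f : Cn q → X) : Prop where
  area_le : ∃ C₁ > (0 : ℝ), ∃ r₀ > (0 : ℝ), ∀ t > r₀,
    weightedArea hq γ f t ≤ C₁ * t * volBall hq γ f t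
  limsup_eq : ∀ C > (0 : ℝ),
    limsup (fun b : ℝ => ((b / C - Real.log (∫ t in (0 : ℝ)..b, volBall hq γ f t) : ℝ) : EReal))
      atTop = ⊤

/-- `f` is horizontal: its differential takes values in `E`. -/
def IsHorizontal {V : Type*} [NormedAddCommGroup V] [NormedSpace ℂ V]
    {X : Type*} [TopologicalSpace X] [ChartedSpace V X] {r q : ℕ}
    (E : SmoothSubbundle V X r) (f : Cn q → X) : Prop :=
  ∀ z v, (diff f z : Cn q →L[ℂ] V) v ∈ E.fiber (f z)

/-- `X` is partially `p`-hyperbolic in the directions of `E`: there is no `E`-horizontal holomorphic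
map `ℂ^p → X` that is nondegenerate at some point and has subexponential growth (with respect to
some, equivalently any, Hermitian metric on the compact manifold `X`). -/
def IsPartiallyHyperbolic {V : Type*} [NormedAddCommGroup V] [NormedSpace ℂ V]
    {X : Type*} [TopologicalSpace X] [ChartedSpace V X] {r : ℕ}
    (E : SmoothSubbundle V X r) (p : ℕ) (hp : 1 ≤ p) : Prop :=
  ¬ ∃ f : Cn p → X, ContMDiff 𝓘(ℂ, Cn p) 𝓘(ℂ, V) ω f ∧ IsHorizontal E f ∧
    (∃ z, Function.Injective (diff f z : Cn p →L[ℂ] V)) ∧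
    ∃ γ : DiffForm V X 2, IsHermitianMetric γ ∧ HasSubexponentialGrowth hp γ f

end PartialHyp

end

/-!
The argument is by volume growth. Let `f : ℂ^p → X` be a horizontal holomorphic map that is
nondegenerate somewhere, with subexponential growth for a metric `γ`. By compactness `γ` is
comparable to `ω = γE + γN` (`exists_quad_le`). Lift `f` to a holomorphic map `F` into the universal
cover (`exists_holomorphic_lift`). As `γN` vanishes on `E`, the volume form of `f^* ω` is
`f^* (γE ^ p / p!) = d (F^* Γ)`, with `Γ` bounded. Stokes' theorem (`ballIntegral_extDeriv`) turns
the volume of `B_t` into the integral of `F^* Γ` over `S_t`, and boundedness of `Γ` controls this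
integral by the area of `S_t`. If `V(t)` is the volume of `B_t`, Cauchy--Schwarz then gives
`V(t) ^ 2 ≤ const * (t⁻¹ ∫_{S_t} |dτ| dσ) * V'(t)`, and by the growth hypothesis the factor in
parentheses is at most `const * V(t)`; hence `V ≤ K V'` for large `t` (`volume_le_deriv`). Therefore
`V` grows at least like `exp (t / K)`, and the upper limit in the growth hypothesis, taken with the
constant `K`, is finite (`exists_limsup_lt_top`): a contradiction.

The metric `f^* γ` degenerates on a closed set, and no information on that set is needed. In
top degree, a form bounded by the metric is bounded by the volume form (`IsSemiposForm.abs_top_le`),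
and on the degeneracy set both sides of the pointwise inequality `sq_covecWedge_le` behind
Cauchy--Schwarz vanish. What has to be checked is that the weighted area is the integral of an
integrable function (`integrable_areaDensity`), although its density may be discontinuous there.
-/

noncomputable section

namespace PartialHyp

/-! ### Positive semi-definite `(1,1)`-forms and their powers -/

section Semipos

variable {V : Type*} [NormedAddCommGroup V] [NormedSpace ℂ V]

/-- A real `(1,1)`-form on a single complex vector space whose Hermitian form is positive
semi-definite. -/
structure IsSemiposForm (a : V [⋀^Fin 2]→L[ℝ] ℝ) : Prop where
  oneOne : ∀ u v : V, a ![Complex.I • u, Complex.I • v] = a ![u, v]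
  nonneg : ∀ u : V, 0 ≤ quad a u

variable {a : V [⋀^Fin 2]→L[ℝ] ℝ}

theorem update_pair_zero {V : Type*} [DecidableEq (Fin 2)] (u v x : V) :
    Function.update ![u, v] 0 x = ![x, v] := by
  ext i; fin_cases i <;> simp

theorem form_add_left (a : V [⋀^Fin 2]→L[ℝ] ℝ) (u u' v : V) :
    a ![u + u', v] = a ![u, v] + a ![u', v] := by
  have := a.map_update_add ![u, v] 0 u u'
  rwa [update_pair_zero, update_pair_zero, update_pair_zero] at this

theorem form_smul_left (a : V [⋀^Fin 2]→L[ℝ] ℝ) (c : ℝ) (u v : V) :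
    a ![c • u, v] = c * a ![u, v] := by
  have := a.map_update_smul ![u, v] 0 c u
  rwa [update_pair_zero, update_pair_zero] at this

theorem form_swap (a : V [⋀^Fin 2]→L[ℝ] ℝ) (u v : V) : a ![u, v] = - a ![v, u] := by
  have := a.toAlternatingMap.map_swap ![v, u] (show (0 : Fin 2) ≠ 1 by decide)
  rw [← ContinuousAlternatingMap.coe_toAlternatingMap, ← this]
  congr 1
  ext i; fin_cases i <;> simp

theorem form_add_right (a : V [⋀^Fin 2]→L[ℝ] ℝ) (u v v' : V) :
    a ![u, v + v'] = a ![u, v] + a ![u, v'] := by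
  rw [form_swap, form_add_left, form_swap a v, form_swap a v']; ring

theorem form_smul_right (a : V [⋀^Fin 2]→L[ℝ] ℝ) (c : ℝ) (u v : V) :
    a ![u, c • v] = c * a ![u, v] := by
  rw [form_swap, form_smul_left, form_swap a v]; ring

theorem form_neg_right (a : V [⋀^Fin 2]→L[ℝ] ℝ) (u v : V) :
    a ![u, - v] = - a ![u, v] := by
  have := form_smul_right a (-1) u v
  simpa using this

theorem I_smul_I_smul (u : V) : Complex.I • Complex.I • u = -u := by
  rw [smul_smul, Complex.I_mul_I, neg_one_smul]

/-- The real bilinear form `(u, v) ↦ a (u, i v)` attached to a real `2`-form; for a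
positive definite `(1,1)`-form this is the Riemannian metric. -/
def metricForm (a : V [⋀^Fin 2]→L[ℝ] ℝ) : V →ₗ[ℝ] V →ₗ[ℝ] ℝ :=
  LinearMap.mk₂ ℝ (fun u v => a ![u, Complex.I • v]) (fun u u' v => form_add_left a _ _ _)
    (fun c u v => form_smul_left a _ _ _)
    (fun u v v' => by rw [smul_add, form_add_right])
    (fun c u v => by rw [smul_comm, form_smul_right]; rfl)

theorem metricForm_apply (a : V [⋀^Fin 2]→L[ℝ] ℝ) (u v : V) :
    metricForm a u v = a ![u, Complex.I • v] := rfl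

namespace IsSemiposForm

theorem symm (ha : IsSemiposForm a) (u v : V) :
    a ![u, Complex.I • v] = a ![v, Complex.I • u] := by
  rw [← ha.oneOne u, I_smul_I_smul, form_neg_right, form_swap a v]

theorem quad_I_smul (ha : IsSemiposForm a) (u : V) : quad a (Complex.I • u) = quad a u :=
  ha.oneOne _ _

/-- The Cauchy--Schwarz inequality for the metric of `a`. -/
theorem sq_le (ha : IsSemiposForm a) (u v : V) :
    (a ![u, Complex.I • v]) ^ 2 ≤ quad a u * quad a v :=
  LinearMap.BilinForm.apply_sq_le_of_symm (metricForm a) ha.nonneg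
    ⟨fun u v => by simpa [metricForm_apply] using ha.symm u v⟩ u v

theorem abs_metric_le (ha : IsSemiposForm a) (u v : V) :
    |a ![u, Complex.I • v]| ≤ √(quad a u) * √(quad a v) := by
  rw [← Real.sqrt_mul (ha.nonneg u)]
  exact Real.abs_le_sqrt (ha.sq_le u v)

theorem abs_le (ha : IsSemiposForm a) (u v : V) :
    |a ![u, v]| ≤ √(quad a u) * √(quad a v) := by
  have := ha.abs_metric_le u (-(Complex.I • v))
  rw [← ha.quad_I_smul (-(Complex.I • v)), smul_neg, I_smul_I_smul, neg_neg] at this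
  exact this

end IsSemiposForm

/-- The two elements `2 i` and `2 i + 1` of each pair, as an enumeration of `Fin (2 p)`. -/
def pairEquiv (p k : ℕ) (hk : k = 2 * p) : Fin p × Fin 2 ≃ Fin k :=
  finProdFinEquiv.trans (finCongr (by omega))

theorem pairEquiv_zero {p k : ℕ} (hk : k = 2 * p) (i : Fin p) :
    pairEquiv p k hk (i, 0) = ⟨2 * i, by omega⟩ := by
  ext; simp [pairEquiv]

theorem pairEquiv_one {p k : ℕ} (hk : k = 2 * p) (i : Fin p) :
    pairEquiv p k hk (i, 1) = ⟨2 * i + 1, by omega⟩ := by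
  ext; simp [pairEquiv]; omega

theorem prod_pairs {p k : ℕ} (hk : k = 2 * p) (F : Fin k → ℝ) :
    ∏ i : Fin p, F ⟨2 * i, by omega⟩ * F ⟨2 * i + 1, by omega⟩ = ∏ j, F j := by
  rw [← (pairEquiv p k hk).prod_comp, Fintype.prod_prod_type]
  refine Finset.prod_congr rfl fun i _ => ?_
  rw [Fin.prod_univ_two, pairEquiv_zero, pairEquiv_one]

theorem divPow_apply (a : V [⋀^Fin 2]→L[ℝ] ℝ) {p k : ℕ} (hk : k = 2 * p) (v : Fin k → V) :
    divPow a p k hk v = ((2 : ℝ) ^ p * (p.factorial : ℝ))⁻¹ *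
      ∑ σ : Equiv.Perm (Fin k), (Equiv.Perm.sign σ : ℝ) *
        ∏ i : Fin p, a ![v (σ (pairEquiv p k hk (i, 0))), v (σ (pairEquiv p k hk (i, 1)))] := by
  simp only [divPow, ContinuousAlternatingMap.smul_apply, smul_eq_mul,
    ContinuousMultilinearMap.alternatization_apply_apply, pairEquiv_zero, pairEquiv_one]
  congr 1
  refine Finset.sum_congr rfl fun σ _ => ?_
  rw [Units.smul_def, zsmul_eq_mul]
  rfl

theorem abs_divPow_le_of_forall {p k : ℕ} (hk : k = 2 * p) (a : V [⋀^Fin 2]→L[ℝ] ℝ)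
    (v : Fin k → V) (B : ℝ)
    (h : ∀ σ : Equiv.Perm (Fin k), ∏ i : Fin p, |a ![v (σ (pairEquiv p k hk (i, 0))),
      v (σ (pairEquiv p k hk (i, 1)))]| ≤ B) :
    |divPow a p k hk v| ≤ k.factorial * B := by
  rw [divPow_apply, abs_mul]
  have h1 : |((2 : ℝ) ^ p * (p.factorial : ℝ))⁻¹| ≤ 1 := by
    rw [abs_of_nonneg (by positivity)]
    apply inv_le_one_of_one_le₀
    have h2 : (1 : ℝ) ≤ 2 ^ p := one_le_pow₀ (by norm_num)
    have h3 : (1 : ℝ) ≤ p.factorial := by exact_mod_cast p.factorial_pos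
    nlinarith
  have h2 : |∑ σ : Equiv.Perm (Fin k), (Equiv.Perm.sign σ : ℝ) *
        ∏ i : Fin p, a ![v (σ (pairEquiv p k hk (i, 0))), v (σ (pairEquiv p k hk (i, 1)))]| ≤
      k.factorial * B := by
    refine (Finset.abs_sum_le_sum_abs _ _).trans ?_
    have : ∀ σ ∈ (Finset.univ : Finset (Equiv.Perm (Fin k))), |(Equiv.Perm.sign σ : ℝ) *
        ∏ i : Fin p, a ![v (σ (pairEquiv p k hk (i, 0))), v (σ (pairEquiv p k hk (i, 1)))]| ≤
          B := by
      intro σ _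
      rw [abs_mul, Finset.abs_prod]
      have : |((Equiv.Perm.sign σ : ℤ) : ℝ)| = 1 := by
        rcases Int.units_eq_one_or (Equiv.Perm.sign σ) with h | h <;> simp [h]
      rw [this, one_mul]
      exact h σ
    refine (Finset.sum_le_card_nsmul _ _ _ this).trans ?_
    simp [Fintype.card_perm]
  calc _ ≤ 1 * _ := mul_le_mul_of_nonneg_right h1 (abs_nonneg _)
    _ ≤ _ := by rw [one_mul]; exact h2

theorem IsSemiposForm.abs_divPow_le (ha : IsSemiposForm a) {p k : ℕ} (hk : k = 2 * p)
    (v : Fin k → V) : |divPow a p k hk v| ≤ k.factorial * ∏ j, √(quad a (v j)) := by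
  refine abs_divPow_le_of_forall hk a v _ fun σ => ?_
  rw [← Equiv.prod_comp σ (fun j => √(quad a (v j))), ← prod_pairs hk]
  refine Finset.prod_le_prod (fun _ _ => abs_nonneg _) fun i _ => ?_
  rw [pairEquiv_zero, pairEquiv_one]
  exact ha.abs_le _ _

/-- A unitary frame gives the power of the form a definite positive value: only the permutations
that map pairs to pairs contribute, and each of them contributes `1`, its sign being cancelled
by the signs of the factors. -/
theorem divPow_unitary_ge {p k : ℕ} (hk : k = 2 * p) (v : Fin k → V)
    (hv : ∀ x y : Fin p × Fin 2, a ![v (pairEquiv p k hk x), v (pairEquiv p k hk y)] =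
      if x.1 = y.1 then ((y.2 : ℕ) : ℝ) - ((x.2 : ℕ) : ℝ) else 0) :
    ((2 : ℝ) ^ p * (p.factorial : ℝ))⁻¹ ≤ divPow a p k hk v := by
  classical
  rw [divPow_apply]
  set e := pairEquiv p k hk with he
  refine le_mul_of_one_le_right (by positivity) ?_
  have hnn : ∀ σ ∈ (Finset.univ : Finset (Equiv.Perm (Fin k))), 0 ≤ (Equiv.Perm.sign σ : ℝ) *
      ∏ i : Fin p, a ![v (σ (e (i, 0))), v (σ (e (i, 1)))] := by
    intro σ _
    by_cases h0 : ∏ i : Fin p, a ![v (σ (e (i, 0))), v (σ (e (i, 1)))] = 0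
    · rw [h0, mul_zero]
    set s : Equiv.Perm (Fin p × Fin 2) := (e.trans σ).trans e.symm with hs
    have hse : ∀ x, σ (e x) = e (s x) := fun x => by simp [hs]
    simp only [hse, hv] at h0 ⊢
    rw [Finset.prod_eq_zero_iff, not_exists] at h0
    have h1 : ∀ i, (s (i, 0)).1 = (s (i, 1)).1 := by
      intro i
      by_contra h
      exact h0 i ⟨Finset.mem_univ _, by rw [if_neg h]⟩
    set τ : Fin p → Fin p := fun i => (s (i, 0)).1 with hτ
    have h1' : ∀ i j, (s (i, j)).1 = τ i := by
      intro i j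
      fin_cases j
      · rfl
      · exact (h1 i).symm
    have hρ : ∀ i, Function.Injective fun j => (s (i, j)).2 := by
      intro i j j' hjj
      have : s (i, j) = s (i, j') := Prod.ext (by rw [h1', h1']) hjj
      simpa using s.injective this
    have hτs : Function.Surjective τ := by
      intro i
      obtain ⟨⟨x, y⟩, hx⟩ := s.surjective (i, 0)
      exact ⟨x, by rw [← h1' x y, hx]⟩
    let T : Equiv.Perm (Fin p) := Equiv.ofBijective τ (Finite.injective_iff_bijective.1
      (Finite.injective_iff_surjective.2 hτs))
    let R : Fin p → Equiv.Perm (Fin 2) := fun i =>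
      Equiv.ofBijective _ (Finite.injective_iff_bijective.1 (hρ i))
    have hsd : s = Equiv.prodCongrLeft (fun _ => T) * Equiv.prodCongrRight R := by
      ext1 ⟨i, j⟩
      exact Prod.ext (h1' i j) rfl
    have hsign : Equiv.Perm.sign σ = ∏ i, Equiv.Perm.sign (R i) := by
      have h2 : Equiv.Perm.sign s = Equiv.Perm.sign σ := by
        rw [hs]
        exact Equiv.Perm.sign_symm_trans_trans σ e.symm
      rw [← h2, hsd, Equiv.Perm.sign_mul, Equiv.Perm.sign_prodCongrLeft,
        Equiv.Perm.sign_prodCongrRight]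
      simp
    have hfac : ∀ i, (if (s (i, 0)).1 = (s (i, 1)).1 then
        (((s (i, 1)).2 : ℕ) : ℝ) - (((s (i, 0)).2 : ℕ) : ℝ) else 0) =
        ((Equiv.Perm.sign (R i) : ℤ) : ℝ) := by
      intro i
      rw [if_pos (h1 i)]
      have e0 : (s (i, 0)).2 = R i 0 := rfl
      have e1 : (s (i, 1)).2 = R i 1 := rfl
      rw [e0, e1]
      generalize R i = ρ
      have : ∀ ρ : Equiv.Perm (Fin 2), ((ρ 1 : ℕ) : ℤ) - ((ρ 0 : ℕ) : ℤ) =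
        (Equiv.Perm.sign ρ : ℤ) := by decide
      have := this ρ
      exact_mod_cast this
    rw [Finset.prod_congr rfl fun i _ => hfac i, hsign]
    push_cast
    exact mul_self_nonneg _
  refine le_trans (le_of_eq ?_) (Finset.single_le_sum hnn (Finset.mem_univ 1))
  simp [hv]

end Semipos

/-! ### Frames and top-degree forms on `ℂ^q` -/

section Frames

variable {V : Type*} [NormedAddCommGroup V] [NormedSpace ℂ V]
variable {W : Type*} [NormedAddCommGroup W] [NormedSpace ℂ W]
variable {a : V [⋀^Fin 2]→L[ℝ] ℝ} {q : ℕ}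

/-- The real basis `b₁, i b₁, b₂, i b₂, …` underlying a complex basis `b`. -/
def realFrame (hq : 1 ≤ q) (b : Module.Basis (Fin q) ℂ V) :
    Module.Basis (Fin (2 * q - 1 + 1)) ℝ V :=
  (Complex.basisOneI.smulTower b).reindex
    ((Equiv.prodComm _ _).trans (pairEquiv q (2 * q - 1 + 1) (by omega)))

theorem realFrame_pair (hq : 1 ≤ q) (b : Module.Basis (Fin q) ℂ V) (x : Fin q × Fin 2) :
    realFrame hq b (pairEquiv q (2 * q - 1 + 1) (by omega) x) = Complex.I ^ (x.2 : ℕ) • b x.1 := by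
  rw [realFrame, Module.Basis.reindex_apply]
  obtain ⟨i, j⟩ := x
  fin_cases j <;> simp [Module.Basis.smulTower_apply]

theorem stdFrame_eq (hq : 1 ≤ q) :
    stdFrame q = realFrame hq (EuclideanSpace.basisFun (Fin q) ℂ).toBasis := by
  ext1 j
  obtain ⟨⟨i, l⟩, rfl⟩ := (pairEquiv q (2 * q - 1 + 1) (by omega)).surjective j
  rw [realFrame_pair]
  have hi : ((pairEquiv q (2 * q - 1 + 1) (by omega) (i, l) : Fin _) : ℕ) = 2 * i + l := by
    simp [pairEquiv]; omega
  have hl := l.2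
  have h1 : (2 * (i : ℕ) + l) / 2 = i := by omega
  have h2 : (2 * (i : ℕ) + l) % 2 = l := by omega
  have h3 : (2 * (i : ℕ) + l) / 2 < q := by omega
  simp only [stdFrame, hi, h2]
  rw [dif_pos h3]
  simp only [h1, Fin.eta, OrthonormalBasis.coe_toBasis, EuclideanSpace.basisFun_apply]
  ext m
  simp [PiLp.single_apply]

/-- All complex frames of a complex vector space have the same orientation. -/
theorem exists_pos_frame_ratio (hq : 1 ≤ q) (b b' : Module.Basis (Fin q) ℂ V) :
    ∃ c : ℝ, 0 < c ∧ ∀ β : V [⋀^Fin (2 * q - 1 + 1)]→L[ℝ] ℝ,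
      β (realFrame hq b) = c * β (realFrame hq b') := by
  let A : V ≃ₗ[ℂ] V := b'.equiv b (Equiv.refl _)
  refine ⟨LinearMap.det ((A : V →ₗ[ℂ] V).restrictScalars ℝ), ?_, fun β => ?_⟩
  · rw [LinearMap.det_restrictScalars, Algebra.norm_complex_apply]
    exact Complex.normSq_pos.2 (LinearEquiv.isUnit_det' A).ne_zero
  · have h1 : (realFrame hq b : _ → V) =
        ((A : V →ₗ[ℂ] V).restrictScalars ℝ) ∘ realFrame hq b' := by
      ext1 j
      obtain ⟨x, rfl⟩ := (pairEquiv q (2 * q - 1 + 1) (by omega)).surjective j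
      simp only [Function.comp_apply, realFrame_pair, LinearMap.coe_restrictScalars, map_smul]
      simp [A]
    have h2 := AlternatingMap.eq_smul_basis_det (realFrame hq b') β.toAlternatingMap
    have h3 : ∀ v, β v = β (realFrame hq b') * (realFrame hq b').det v := fun v => by
      have := congrArg (fun f => f v) h2
      simpa using this
    rw [h1, h3 (_ ∘ _), Module.Basis.det_comp, Module.Basis.det_self]
    ring

theorem IsSemiposForm.comp (ha : IsSemiposForm a) (A : W →L[ℂ] V) :
    IsSemiposForm (a.compContinuousLinearMap (A.restrictScalars ℝ)) where
  oneOne u v := by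
    have := ha.oneOne (A u) (A v)
    simp only [ContinuousAlternatingMap.compContinuousLinearMap_apply]
    convert this using 2
    all_goals ext i; fin_cases i <;> simp
  nonneg u := by
    have := ha.nonneg (A u)
    simp only [quad, ContinuousAlternatingMap.compContinuousLinearMap_apply] at this ⊢
    convert this using 2
    ext i; fin_cases i <;> simp

theorem quad_comp (a : V [⋀^Fin 2]→L[ℝ] ℝ) (A : W →L[ℂ] V) (u : W) :
    quad (a.compContinuousLinearMap (A.restrictScalars ℝ)) u = quad a (A u) := by
  simp only [quad, ContinuousAlternatingMap.compContinuousLinearMap_apply]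
  congr 1
  ext i; fin_cases i <;> simp

theorem divPow_comp (a : V [⋀^Fin 2]→L[ℝ] ℝ) (A : W →L[ℝ] V) (p k : ℕ) (hk : k = 2 * p) :
    divPow (a.compContinuousLinearMap A) p k hk =
      (divPow a p k hk).compContinuousLinearMap A := by
  ext v
  rw [ContinuousAlternatingMap.compContinuousLinearMap_apply, divPow_apply, divPow_apply]
  simp only [ContinuousAlternatingMap.compContinuousLinearMap_apply]
  congr 1
  refine Finset.sum_congr rfl fun σ _ => ?_
  congr 1
  refine Finset.prod_congr rfl fun i _ => ?_
  congr 1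
  ext j; fin_cases j <;> rfl

theorem herm_conj (ha : IsSemiposForm a) (u v : V) :
    (starRingEnd ℂ) (herm a u v) = herm a v u := by
  simp only [herm, map_sub, map_mul, Complex.conj_ofReal, Complex.conj_I]
  rw [ha.symm u v, form_swap a u v]
  push_cast; ring

/-- The Hermitian inner product of a positive definite `(1,1)`-form. Since `herm` is linear in the
first argument and inner products are linear in the second, the arguments are exchanged. -/
@[reducible] def hermCore (ha : IsSemiposForm a) (hpos : ∀ u, u ≠ 0 → 0 < quad a u) :
    InnerProductSpace.Core ℂ V where
  inner u v := herm a v u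
  conj_inner_symm u v := herm_conj ha _ _
  re_inner_nonneg u := by
    have := ha.nonneg u
    have h0 : a ![u, u] = 0 := by have := form_swap a u u; linarith
    simpa [herm, h0, quad] using this
  add_left u v w := by
    change herm a w (u + v) = herm a w u + herm a w v
    simp only [herm, smul_add, form_add_right]
    push_cast; ring
  smul_left u v r := by
    change herm a v (r • u) = _ * herm a v u
    have h : r • u = r.re • u + r.im • Complex.I • u := by
      conv_lhs => rw [← Complex.re_add_im r]
      rw [add_smul, mul_smul]; simp
    rw [h]
    simp only [herm, smul_add, form_add_right]
    rw [smul_comm Complex.I r.re, smul_comm Complex.I r.im, I_smul_I_smul]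
    simp only [form_smul_right, form_neg_right]
    have hr : (starRingEnd ℂ) r = r.re - r.im * Complex.I := by
      apply Complex.ext <;> simp
    rw [hr]
    push_cast
    linear_combination (-(r.im : ℂ) * (a ![v, u] : ℂ)) * Complex.I_mul_I
  definite u hu := by
    by_contra h
    have h1 := hpos u h
    have h2 := congrArg Complex.re hu
    have h0 : a ![u, u] = 0 := by have := form_swap a u u; linarith
    simp [herm, h0] at h2
    simp only [quad] at h1
    linarith

/-- Orthonormal bases exist for an inner product given as a bare `InnerProductSpace.Core`, so that a
space with a fixed norm can be endowed with another inner product. -/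
theorem exists_basis_of_core {F : Type*} [AddCommGroup F] [Module ℂ F] [FiniteDimensional ℂ F]
    (c : InnerProductSpace.Core ℂ F) (hF : Module.finrank ℂ F = q) :
    ∃ b : Module.Basis (Fin q) ℂ F, ∀ i j, c.inner (b i) (b j) = if i = j then 1 else 0 := by
  let _ : NormedAddCommGroup F := c.toNormedAddCommGroup
  let _ : InnerProductSpace ℂ F := InnerProductSpace.ofCore c.toCore
  let o : OrthonormalBasis (Fin q) ℂ F := (stdOrthonormalBasis ℂ F).reindex (finCongr hF)
  refine ⟨o.toBasis, fun i j => ?_⟩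
  have := orthonormal_iff_ite.1 o.orthonormal i j
  rw [o.coe_toBasis]
  exact this

/-- A complex basis that is unitary for a positive definite `(1,1)`-form. -/
theorem IsSemiposForm.exists_unitary (ha : IsSemiposForm a) (hpos : ∀ u, u ≠ 0 → 0 < quad a u)
    [FiniteDimensional ℂ V] (hV : Module.finrank ℂ V = q) :
    ∃ b : Module.Basis (Fin q) ℂ V, ∀ i j, a ![b i, Complex.I • b j] = (if i = j then 1 else 0) ∧
      a ![b i, b j] = 0 := by
  obtain ⟨b, hb⟩ := exists_basis_of_core (hermCore ha hpos) hV
  refine ⟨b, fun i j => ?_⟩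
  have h := hb j i
  change herm a (b i) (b j) = _ at h
  have hre := congrArg Complex.re h
  have him := congrArg Complex.im h
  have e1 : (if j = i then (1 : ℂ) else 0).re = if i = j then 1 else 0 := by
    simp only [eq_comm (a := j)]
    split_ifs <;> simp
  have e2 : (if j = i then (1 : ℂ) else 0).im = 0 := by split_ifs <;> simp
  rw [e1] at hre
  rw [e2] at him
  simp only [herm, Complex.sub_re, Complex.ofReal_re, Complex.mul_re, Complex.I_re, Complex.I_im,
    Complex.ofReal_im, Complex.sub_im, Complex.mul_im] at hre him
  constructor <;> linarith

theorem unitary_frame_apply (ha : IsSemiposForm a) (hq : 1 ≤ q) (b : Module.Basis (Fin q) ℂ V)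
    (hb : ∀ i j, a ![b i, Complex.I • b j] = (if i = j then 1 else 0) ∧ a ![b i, b j] = 0)
    (x y : Fin q × Fin 2) :
    a ![realFrame hq b (pairEquiv q (2 * q - 1 + 1) (by omega) x),
      realFrame hq b (pairEquiv q (2 * q - 1 + 1) (by omega) y)] =
      if x.1 = y.1 then ((y.2 : ℕ) : ℝ) - ((x.2 : ℕ) : ℝ) else 0 := by
  rw [realFrame_pair, realFrame_pair]
  obtain ⟨i, l⟩ := x
  obtain ⟨j, m⟩ := y
  fin_cases l <;> fin_cases m <;> simp only [pow_zero, pow_one,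
    one_smul, Nat.cast_zero, Nat.cast_one, sub_zero, sub_self, zero_sub, ite_self]
  · exact (hb i j).2
  · exact (hb i j).1
  · rw [form_swap, (hb j i).1]
    by_cases h : i = j
    · simp [h]
    · simp [h, Ne.symm h]
  · rw [ha.oneOne]; exact (hb i j).2

end Frames

section TopForms

variable {q : ℕ} {a : Cn q [⋀^Fin 2]→L[ℝ] ℝ}

/-- The value of `a_q` on the standard frame, i.e. the density of `a_q` with respect to Lebesgue
measure. -/
def volDensity (q : ℕ) (hq : 1 ≤ q) (a : Cn q [⋀^Fin 2]→L[ℝ] ℝ) : ℝ :=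
  divPow a q (2 * q - 1 + 1) (by omega) (stdFrame q)

/-- The constant of `IsSemiposForm.abs_top_le`: the inverse of the coefficient in front of the sum
defining `divPow`, which is the lower bound of `a_q` on unitary frames. -/
def topConst (q : ℕ) : ℝ := (2 : ℝ) ^ q * (q.factorial : ℝ)

theorem topConst_pos (q : ℕ) : 0 < topConst q := by unfold topConst; positivity

theorem exists_basis_zero (hq : 1 ≤ q) {u : Cn q} (hu : u ≠ 0) :
    ∃ b : Module.Basis (Fin q) ℂ (Cn q), b ⟨0, hq⟩ = u := by
  let b₀ := (EuclideanSpace.basisFun (Fin q) ℂ).toBasis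
  obtain ⟨A, hA⟩ := SeparatingDual.exists_continuousLinearEquiv_apply_eq (R := ℂ)
    (b₀.ne_zero ⟨0, hq⟩) hu
  exact ⟨b₀.map A.toLinearEquiv, by simpa using hA⟩

/-- A top form vanishes as soon as it vanishes on all families starting with `u, i u`, for one
`u ≠ 0`: such a family can be completed to a frame. -/
theorem top_eq_zero_of_degenerate (hq : 1 ≤ q) {u : Cn q} (hu : u ≠ 0)
    (β : Cn q [⋀^Fin (2 * q - 1 + 1)]→L[ℝ] ℝ)
    (hβ : ∀ v : Fin (2 * q - 1 + 1) → Cn q,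
      v (pairEquiv q _ (by omega) (⟨0, hq⟩, 0)) = u →
      v (pairEquiv q _ (by omega) (⟨0, hq⟩, 1)) = Complex.I • u → β v = 0) :
    β (stdFrame q) = 0 := by
  obtain ⟨b, hb⟩ := exists_basis_zero hq hu
  obtain ⟨c, hc, hcβ⟩ := exists_pos_frame_ratio hq b (EuclideanSpace.basisFun (Fin q) ℂ).toBasis
  have h := hcβ β
  rw [hβ _ (by rw [realFrame_pair]; simpa using hb) (by rw [realFrame_pair, ← hb]; simp),
    ← stdFrame_eq] at h
  exact (mul_eq_zero.1 h.symm).resolve_left hc.ne'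

theorem eq_zero_of_stdFrame (hq : 1 ≤ q) (β : Cn q [⋀^Fin (2 * q - 1 + 1)]→L[ℝ] ℝ)
    (h : β (stdFrame q) = 0) : β = 0 := by
  have h2 := AlternatingMap.eq_smul_basis_det
    (realFrame hq (EuclideanSpace.basisFun (Fin q) ℂ).toBasis) β.toAlternatingMap
  ext v
  have := congrArg (fun f => f v) h2
  simp only [ContinuousAlternatingMap.coe_toAlternatingMap, ← stdFrame_eq, h] at this
  simpa using this

theorem volDensity_eq_zero (ha : IsSemiposForm a) (hq : 1 ≤ q) {u : Cn q} (hu : u ≠ 0)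
    (h0 : quad a u = 0) : volDensity q hq a = 0 := by
  refine top_eq_zero_of_degenerate hq hu _ fun v hv0 _ => ?_
  have := ha.abs_divPow_le (p := q) (k := 2 * q - 1 + 1) (by omega) v
  rw [Finset.prod_eq_zero (Finset.mem_univ (pairEquiv q _ (by omega) (⟨0, hq⟩, 0)))
    (by rw [hv0, h0, Real.sqrt_zero]), mul_zero] at this
  exact abs_eq_zero.1 (le_antisymm this (abs_nonneg _))

/-- The vectors `v` form a unitary frame for `a`, and `c` is the determinant of `v` in the standard
frame. -/
theorem unitary_density (ha : IsSemiposForm a) (hq : 1 ≤ q)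
    (hpos : ∀ u, u ≠ 0 → 0 < quad a u) :
    ∃ (v : Fin (2 * q - 1 + 1) → Cn q) (c : ℝ), 0 < c ∧ (∀ j, quad a (v j) = 1) ∧
      (∀ β : Cn q [⋀^Fin (2 * q - 1 + 1)]→L[ℝ] ℝ, β v = c * β (stdFrame q)) ∧
      (topConst q)⁻¹ ≤ c * volDensity q hq a := by
  obtain ⟨b, hb⟩ := ha.exists_unitary hpos (q := q) (by simp)
  obtain ⟨c, hc, hcβ⟩ := exists_pos_frame_ratio hq b (EuclideanSpace.basisFun (Fin q) ℂ).toBasis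
  rw [← stdFrame_eq] at hcβ
  refine ⟨realFrame hq b, c, hc, fun j => ?_, hcβ, ?_⟩
  · obtain ⟨⟨i, l⟩, rfl⟩ := (pairEquiv q (2 * q - 1 + 1) (by omega)).surjective j
    rw [realFrame_pair]
    fin_cases l
    · simpa [quad] using (hb i i).1
    · change quad a (Complex.I ^ 1 • b i) = 1
      rw [pow_one, ha.quad_I_smul]
      simpa [quad] using (hb i i).1
  · rw [volDensity, ← hcβ]
    exact divPow_unitary_ge _ _ (unitary_frame_apply ha hq b hb)

theorem IsSemiposForm.degenerate_or_pos (ha : IsSemiposForm a) :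
    (∃ u, u ≠ 0 ∧ quad a u = 0) ∨ ∀ u, u ≠ 0 → 0 < quad a u := by
  by_cases h : ∃ u, u ≠ 0 ∧ quad a u = 0
  · exact Or.inl h
  · push Not at h
    exact Or.inr fun u hu => (ha.nonneg u).lt_of_ne' (h u hu)

theorem volDensity_pos (ha : IsSemiposForm a) (hq : 1 ≤ q) (hpos : ∀ u, u ≠ 0 → 0 < quad a u) :
    0 < volDensity q hq a := by
  obtain ⟨v, c, hc, -, -, h⟩ := unitary_density ha hq hpos
  have := (inv_pos.2 (topConst_pos q)).trans_le h
  exact (pos_iff_pos_of_mul_pos this).1 hc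

theorem volDensity_nonneg (ha : IsSemiposForm a) (hq : 1 ≤ q) : 0 ≤ volDensity q hq a := by
  rcases ha.degenerate_or_pos with ⟨u, hu, h0⟩ | h
  · exact (volDensity_eq_zero ha hq hu h0).ge
  · exact (volDensity_pos ha hq h).le

/-- A top form bounded by the metric of `a` is bounded by the volume form of `a`. -/
theorem IsSemiposForm.abs_top_le (ha : IsSemiposForm a) (hq : 1 ≤ q)
    (β : Cn q [⋀^Fin (2 * q - 1 + 1)]→L[ℝ] ℝ) {C : ℝ}
    (hβ : ∀ v, |β v| ≤ C * ∏ j, √(quad a (v j))) :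
    |β (stdFrame q)| ≤ C * topConst q * volDensity q hq a := by
  rcases ha.degenerate_or_pos with ⟨u, hu, h0⟩ | hpos
  · have : β (stdFrame q) = 0 := by
      refine top_eq_zero_of_degenerate hq hu _ fun v hv0 _ => ?_
      have := hβ v
      rw [Finset.prod_eq_zero (Finset.mem_univ (pairEquiv q _ (by omega) (⟨0, hq⟩, 0)))
        (by rw [hv0, h0, Real.sqrt_zero]), mul_zero] at this
      exact abs_eq_zero.1 (le_antisymm this (abs_nonneg _))
    rw [this, volDensity_eq_zero ha hq hu h0]; simp
  · obtain ⟨v, c, hc, hv1, hcβ, hD⟩ := unitary_density ha hq hpos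
    have h := hβ v
    simp only [hv1, Real.sqrt_one, Finset.prod_const_one, mul_one] at h
    have hC : 0 ≤ C := (abs_nonneg _).trans h
    rw [hcβ, abs_mul, abs_of_pos hc] at h
    have h2 : 1 ≤ topConst q * (c * volDensity q hq a) := by
      have := mul_le_mul_of_nonneg_left hD (topConst_pos q).le
      rwa [mul_inv_cancel₀ (topConst_pos q).ne'] at this
    have h3 : c * |β (stdFrame q)| ≤ c * (C * topConst q * volDensity q hq a) := by
      calc _ ≤ C * 1 := by rw [mul_one]; exact h
        _ ≤ C * (topConst q * (c * volDensity q hq a)) := mul_le_mul_of_nonneg_left h2 hC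
        _ = _ := by ring
    exact le_of_mul_le_mul_left h3 hc

/-- Monotonicity up to a constant of the volume form in the metric. -/
theorem volDensity_le_of_quad_le {a' : Cn q [⋀^Fin 2]→L[ℝ] ℝ} (ha : IsSemiposForm a)
    (ha' : IsSemiposForm a') (hq : 1 ≤ q) {C : ℝ} (hC : 0 ≤ C)
    (h : ∀ u, quad a' u ≤ C * quad a u) :
    volDensity q hq a' ≤
      (2 * q - 1 + 1).factorial * √C ^ (2 * q - 1 + 1) * topConst q * volDensity q hq a := by
  refine (le_abs_self _).trans (ha.abs_top_le hq _ fun v => ?_)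
  refine (ha'.abs_divPow_le _ v).trans ?_
  rw [mul_assoc]
  refine mul_le_mul_of_nonneg_left ?_ (by positivity)
  calc ∏ j, √(quad a' (v j)) ≤ ∏ j, √C * √(quad a (v j)) := by
        refine Finset.prod_le_prod (fun _ _ => Real.sqrt_nonneg _) fun j _ => ?_
        rw [← Real.sqrt_mul hC]
        exact Real.sqrt_le_sqrt (h _)
    _ = _ := by rw [Finset.prod_mul_distrib]; simp

end TopForms

/-! ### Wedge products with covectors and the area form of a metric -/

section Wedge

variable {V : Type*} [NormedAddCommGroup V] [NormedSpace ℂ V]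

theorem covecWedge_apply {k : ℕ} (θ : V →L[ℝ] ℝ) (b : V [⋀^Fin k]→L[ℝ] ℝ) (v : Fin (k + 1) → V) :
    covecWedge θ b v = ∑ i : Fin (k + 1), (-1) ^ (i : ℕ) * (θ (v i) * b (i.removeNth v)) := by
  simp [covecWedge, ContinuousAlternatingMap.alternatizeUncurryFin_apply]

/-- Interior multiplication on a top form: since `θ ∧ β = 0` for degree reasons, contracting with
`w` gives `θ ∧ ι_w β = θ(w) β`. -/
theorem covecWedge_curryLeft {k : ℕ} (e : Module.Basis (Fin (k + 1)) ℝ V) (θ : V →L[ℝ] ℝ)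
    (β : V [⋀^Fin (k + 1)]→L[ℝ] ℝ) (w : V) :
    covecWedge θ (β.curryLeft w) e = θ w * β e := by
  have h0 : covecWedge θ β (Fin.cons w e) = 0 := by
    refine (covecWedge θ β).toAlternatingMap.map_linearDependent _ fun hli => ?_
    have : Module.Finite ℝ V := Module.Finite.of_basis e
    have := hli.fintype_card_le_finrank
    rw [Module.finrank_eq_card_basis e] at this
    simp at this
  rw [covecWedge_apply, Fin.sum_univ_succ] at h0
  rw [covecWedge_apply]
  have h1 : ∀ i : Fin (k + 1), (-1 : ℝ) ^ ((i.succ : Fin (k + 2)) : ℕ) *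
      (θ ((Fin.cons w e : Fin (k + 2) → V) i.succ) *
        β (i.succ.removeNth (Fin.cons w e : Fin (k + 2) → V))) =
      - ((-1) ^ (i : ℕ) * (θ (e i) * (β.curryLeft w) (i.removeNth e))) := by
    intro i
    have h2 : i.succ.removeNth (Fin.cons w e : Fin (k + 2) → V) =
        Matrix.vecCons w (i.removeNth e) := by
      ext1 j
      refine Fin.cases ?_ (fun j => ?_) j
      · simp [Fin.removeNth]
      · simp [Fin.removeNth]
    rw [ContinuousAlternatingMap.curryLeft_apply_apply, h2, Fin.cons_succ, Fin.val_succ, pow_succ]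
    ring
  rw [Finset.sum_congr rfl fun i _ => h1 i, Finset.sum_neg_distrib] at h0
  have h3 : (0 : Fin (k + 2)).removeNth (Fin.cons w e : Fin (k + 2) → V) = e := by
    ext1 j; simp [Fin.removeNth]
  rw [h3] at h0
  simp only [Fin.val_zero, pow_zero, one_mul, Fin.cons_zero] at h0
  linarith

theorem abs_covecWedge_le {k : ℕ} (θ : V →L[ℝ] ℝ) (b : V [⋀^Fin k]→L[ℝ] ℝ) (s : V → ℝ)
    {C N : ℝ} (hN : 0 ≤ N) (hs : ∀ v, 0 ≤ s v)
    (hθ : ∀ v, |θ v| ≤ N * s v) (hb : ∀ v, |b v| ≤ C * ∏ j, s (v j)) (v : Fin (k + 1) → V) :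
    |covecWedge θ b v| ≤ ((k + 1 : ℕ) * N * C) * ∏ j, s (v j) := by
  rw [covecWedge_apply]
  refine (Finset.abs_sum_le_sum_abs _ _).trans ?_
  have h : ∀ i ∈ (Finset.univ : Finset (Fin (k + 1))),
      |(-1 : ℝ) ^ (i : ℕ) * (θ (v i) * b (i.removeNth v))| ≤ (N * C) * ∏ j, s (v j) := by
    intro i _
    rw [abs_mul, abs_pow, abs_neg, abs_one, one_pow, one_mul, abs_mul]
    refine (mul_le_mul (hθ _) (hb _) (abs_nonneg _) (mul_nonneg hN (hs _))).trans (le_of_eq ?_)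
    rw [Fin.prod_univ_succAbove _ i]
    simp only [Fin.removeNth]
    ring
  refine (Finset.sum_le_card_nsmul _ _ _ h).trans (le_of_eq ?_)
  simp; ring

end Wedge

section Metric

variable {q : ℕ} {a : Cn q [⋀^Fin 2]→L[ℝ] ℝ}

/-- The continuous linear version of `metricForm`. -/
def metricCLM (a : Cn q [⋀^Fin 2]→L[ℝ] ℝ) : Cn q →L[ℝ] Cn q →L[ℝ] ℝ :=
  LinearMap.toContinuousLinearMap
    ((LinearMap.toContinuousLinearMap : (Cn q →ₗ[ℝ] ℝ) ≃ₗ[ℝ] _).toLinearMap ∘ₗ metricForm a)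

theorem metricCLM_apply (a : Cn q [⋀^Fin 2]→L[ℝ] ℝ) (u v : Cn q) :
    metricCLM a u v = a ![u, Complex.I • v] := rfl

theorem exists_metricEquiv (hpos : ∀ u, u ≠ 0 → 0 < quad a u) :
    ∃ e : Cn q ≃L[ℝ] (Cn q →L[ℝ] ℝ), (e : Cn q →L[ℝ] Cn q →L[ℝ] ℝ) = metricCLM a := by
  have hinj : Function.Injective (metricCLM a : Cn q →ₗ[ℝ] Cn q →L[ℝ] ℝ) := by
    rw [← LinearMap.ker_eq_bot, LinearMap.ker_eq_bot']
    intro u hu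
    by_contra h
    have h1 := hpos u h
    have h2 : metricCLM a u u = 0 := by
      have : metricCLM a u = 0 := hu
      rw [this]; rfl
    rw [metricCLM_apply] at h2
    exact h1.ne' h2
  have hdim : Module.finrank ℝ (Cn q) = Module.finrank ℝ (Cn q →L[ℝ] ℝ) := by
    rw [← (LinearMap.toContinuousLinearMap : (Cn q →ₗ[ℝ] ℝ) ≃ₗ[ℝ] _).finrank_eq]
    exact (Subspace.dual_finrank_eq).symm
  exact ⟨(LinearEquiv.ofInjectiveOfFinrankEq _ hinj hdim).toContinuousLinearEquiv, by ext; rfl⟩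

theorem sharp_spec (hpos : ∀ u, u ≠ 0 → 0 < quad a u) (θ : Cn q →L[ℝ] ℝ) (v : Cn q) :
    a ![sharp a θ, Complex.I • v] = θ v := by
  obtain ⟨e, he⟩ := exists_metricEquiv hpos
  have h : ∃ w : Cn q, ∀ v, a ![w, Complex.I • v] = θ v := by
    refine ⟨e.symm θ, fun v => ?_⟩
    rw [← metricCLM_apply, ← he]; simp
  rw [sharp, dif_pos h]
  exact h.choose_spec v

theorem metricCLM_sharp (hpos : ∀ u, u ≠ 0 → 0 < quad a u) (θ : Cn q →L[ℝ] ℝ) :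
    metricCLM a (sharp a θ) = θ := by
  ext v; rw [metricCLM_apply, sharp_spec hpos]

/-- For a nondegenerate form, `sharp` is the inverse of the musical isomorphism; hence it depends
continuously on the metric. -/
theorem sharp_eq_inverse (hpos : ∀ u, u ≠ 0 → 0 < quad a u) (θ : Cn q →L[ℝ] ℝ) :
    sharp a θ = (metricCLM a).inverse θ := by
  have h := metricCLM_sharp hpos θ
  obtain ⟨e, he⟩ := exists_metricEquiv hpos
  rw [← he] at h ⊢
  rw [ContinuousLinearMap.inverse_equiv]
  exact e.injective (by simpa using h)

theorem sharp_smul (hpos : ∀ u, u ≠ 0 → 0 < quad a u) (c : ℝ) (θ : Cn q →L[ℝ] ℝ) :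
    sharp a (c • θ) = c • sharp a θ := by
  rw [sharp_eq_inverse hpos, sharp_eq_inverse hpos, map_smul]

theorem quad_sharp (hpos : ∀ u, u ≠ 0 → 0 < quad a u) (θ : Cn q →L[ℝ] ℝ) :
    quad a (sharp a θ) = θ (sharp a θ) := sharp_spec hpos θ _

theorem covecNorm_sq (ha : IsSemiposForm a) (hpos : ∀ u, u ≠ 0 → 0 < quad a u)
    (θ : Cn q →L[ℝ] ℝ) : covecNorm a θ ^ 2 = θ (sharp a θ) := by
  rw [covecNorm, Real.sq_sqrt (ha.nonneg _), quad_sharp hpos]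

theorem abs_le_covecNorm_mul (ha : IsSemiposForm a) (hpos : ∀ u, u ≠ 0 → 0 < quad a u)
    (θ : Cn q →L[ℝ] ℝ) (v : Cn q) : |θ v| ≤ covecNorm a θ * √(quad a v) := by
  rw [← sharp_spec hpos θ v]
  exact ha.abs_metric_le _ _

theorem covecNorm_ne_zero (ha : IsSemiposForm a) (hpos : ∀ u, u ≠ 0 → 0 < quad a u)
    {θ : Cn q →L[ℝ] ℝ} (hθ : θ ≠ 0) : covecNorm a θ ≠ 0 := by
  intro h
  refine hθ (ContinuousLinearMap.ext fun v => ?_)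
  have := abs_le_covecNorm_mul ha hpos θ v
  rw [h, zero_mul] at this
  exact abs_eq_zero.1 (le_antisymm this (abs_nonneg _))

theorem hasFDerivAt_norm_sq (z : Cn q) :
    HasFDerivAt (fun w : Cn q => ‖w‖ ^ 2) (2 • innerSL ℝ z) z :=
  (hasStrictFDerivAt_norm_sq z).hasFDerivAt

theorem dtau_apply (z v : Cn q) : dtau z v = 2 * inner ℝ z v := by
  rw [dtau, (hasFDerivAt_norm_sq z).fderiv]
  simp

theorem dtau_eq (z : Cn q) (hz : z ≠ 0) : dtau z = (2 * ‖z‖) • dr z := by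
  have h : HasFDerivAt (fun w : Cn q => ‖w‖) (dr z) z :=
    ((contDiffAt_norm ℝ hz (n := 1)).differentiableAt (by norm_num)).hasFDerivAt
  have := (h.pow 2).fderiv
  rw [dtau, this]
  simp

theorem dr_eq (z : Cn q) (hz : z ≠ 0) : dr z = (2 * ‖z‖)⁻¹ • dtau z := by
  have : 2 * ‖z‖ ≠ 0 := by simpa using hz
  rw [dtau_eq z hz, smul_smul, inv_mul_cancel₀ this, one_smul]

theorem dtau_ne_zero (z : Cn q) (hz : z ≠ 0) : dtau z ≠ 0 := by
  intro h
  have := dtau_apply z z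
  rw [h, real_inner_self_eq_norm_sq] at this
  simp at this
  exact hz this

/-- The density, with respect to the Euclidean area measure of the sphere through `z`, of
`|dτ| dσ` for the (possibly degenerate) metric of `a`. -/
def areaDensity (hq : 1 ≤ q) (a : Cn q [⋀^Fin 2]→L[ℝ] ℝ) (z : Cn q) : ℝ :=
  covecWedge (dr z) (covecNorm a (dtau z) • hodgeStar hq a ((covecNorm a (dtau z))⁻¹ • dtau z))
    (stdFrame q)

theorem areaDensity_of_eq_zero (hq : 1 ≤ q) (h : volDensity q hq a = 0) (z : Cn q) :
    areaDensity hq a z = 0 := by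
  have h0 : divPow a q (2 * q - 1 + 1) (by omega) = 0 := eq_zero_of_stdFrame hq _ h
  rw [areaDensity, hodgeStar, h0, covecWedge_apply]
  simp

theorem areaDensity_eq_covecWedge (ha : IsSemiposForm a) (hq : 1 ≤ q)
    (hpos : ∀ u, u ≠ 0 → 0 < quad a u) {z : Cn q} (hz : z ≠ 0) :
    areaDensity hq a z = covecWedge (dr z) ((divPow a q (2 * q - 1 + 1) (by omega)).curryLeft
      (sharp a (dtau z))) (stdFrame q) := by
  rw [areaDensity, hodgeStar, sharp_smul hpos, map_smul, smul_smul,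
    mul_inv_cancel₀ (covecNorm_ne_zero ha hpos (dtau_ne_zero z hz)), one_smul]

theorem areaDensity_of_pos (ha : IsSemiposForm a) (hq : 1 ≤ q)
    (hpos : ∀ u, u ≠ 0 → 0 < quad a u) {z : Cn q} (hz : z ≠ 0) :
    areaDensity hq a z =
      (2 * ‖z‖)⁻¹ * dtau z (sharp a (dtau z)) * volDensity q hq a := by
  rw [areaDensity_eq_covecWedge ha hq hpos hz, stdFrame_eq hq, covecWedge_curryLeft, dr_eq z hz,
    volDensity, stdFrame_eq hq]
  rfl

theorem areaDensity_nonneg (ha : IsSemiposForm a) (hq : 1 ≤ q) {z : Cn q} (hz : z ≠ 0) :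
    0 ≤ areaDensity hq a z := by
  rcases ha.degenerate_or_pos with ⟨u, hu, h0⟩ | hpos
  · rw [areaDensity_of_eq_zero hq (volDensity_eq_zero ha hq hu h0)]
  · rw [areaDensity_of_pos ha hq hpos hz, ← covecNorm_sq ha hpos]
    have := volDensity_nonneg ha hq
    positivity

/-- The pointwise form of the Cauchy--Schwarz argument: the restriction to spheres of a bounded
`(2 q - 1)`-form is controlled by the geometric mean of the densities of `|dτ| dσ` and of the
volume form. -/
theorem sq_covecWedge_le (ha : IsSemiposForm a) (hq : 1 ≤ q) {z : Cn q} (hz : z ≠ 0)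
    (β : Cn q [⋀^Fin (2 * q - 1)]→L[ℝ] ℝ) {C : ℝ}
    (hβ : ∀ v, |β v| ≤ C * ∏ j, √(quad a (v j))) :
    (covecWedge (dr z) β (stdFrame q)) ^ 2 ≤
      (((2 * q - 1 + 1 : ℕ) * C * topConst q) ^ 2 * (2 * ‖z‖)⁻¹) *
        (areaDensity hq a z * volDensity q hq a) := by
  rcases ha.degenerate_or_pos with ⟨u, hu, h0⟩ | hpos
  · rw [volDensity_eq_zero ha hq hu h0, mul_zero, mul_zero]
    have : covecWedge (dr z) β (stdFrame q) = 0 := by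
      refine top_eq_zero_of_degenerate hq hu _ fun v hv0 hv1 => ?_
      rw [covecWedge_apply]
      refine Finset.sum_eq_zero fun i _ => ?_
      have h1 : β (i.removeNth v) = 0 := by
        -- one of the two null vectors `u`, `i u` survives the removal of the `i`-th entry
        have : ∃ j : Fin (2 * q - 1), √(quad a (i.removeNth v j)) = 0 := by
          by_cases hi : pairEquiv q _ (by omega) (⟨0, hq⟩, 0) = i
          · have hne : pairEquiv q (2 * q - 1 + 1) (by omega) (⟨0, hq⟩, 1) ≠ i := by
              rw [← hi]
              intro h
              have := (pairEquiv q (2 * q - 1 + 1) (by omega)).injective h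
              simp at this
            obtain ⟨j, hj⟩ := Fin.exists_succAbove_eq hne
            refine ⟨j, ?_⟩
            rw [Fin.removeNth, hj, hv1, ha.quad_I_smul, h0, Real.sqrt_zero]
          · obtain ⟨j, hj⟩ := Fin.exists_succAbove_eq hi
            refine ⟨j, ?_⟩
            rw [Fin.removeNth, hj, hv0, h0, Real.sqrt_zero]
        obtain ⟨j, hj⟩ := this
        have h2 := hβ (i.removeNth v)
        rw [Finset.prod_eq_zero (Finset.mem_univ j) hj, mul_zero] at h2
        exact abs_eq_zero.1 (le_antisymm h2 (abs_nonneg _))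
      rw [h1, mul_zero, mul_zero]
    rw [this]; simp
  · set N := covecNorm a (dtau z) with hN
    have hN0 : 0 ≤ N := Real.sqrt_nonneg _
    have hz' : 0 < ‖z‖ := norm_pos_iff.2 hz
    have h1 : ∀ v, |dr z v| ≤ ((2 * ‖z‖)⁻¹ * N) * √(quad a v) := by
      intro v
      rw [dr_eq z hz, smul_apply, smul_eq_mul, abs_mul,
        abs_of_nonneg (by positivity : (0 : ℝ) ≤ (2 * ‖z‖)⁻¹), mul_assoc]
      exact mul_le_mul_of_nonneg_left (abs_le_covecNorm_mul ha hpos _ v) (by positivity)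
    have h2 := ha.abs_top_le hq (covecWedge (dr z) β)
      (abs_covecWedge_le (dr z) β (fun v => √(quad a v)) (by positivity)
        (fun _ => Real.sqrt_nonneg _) h1 hβ)
    rw [areaDensity_of_pos ha hq hpos hz, ← covecNorm_sq ha hpos, ← hN, ← sq_abs]
    refine (pow_le_pow_left₀ (abs_nonneg _) h2 2).trans (le_of_eq ?_)
    ring

/-- A bound of `areaDensity` by the coefficients of the metric: in the contraction of `a_q` with
the dual vector `w` of `dτ`, this vector only enters through `a (w, v) = - dτ (i v)`. -/
theorem areaDensity_le (ha : IsSemiposForm a) (hq : 1 ≤ q) {z : Cn q} (hz : z ≠ 0) {M : ℝ}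
    (hM : 0 ≤ M) (h1 : ∀ i j, |a ![stdFrame q i, stdFrame q j]| ≤ M)
    (h2 : ∀ i, |dtau z (Complex.I • stdFrame q i)| ≤ M) (h3 : ∀ i, |dr z (stdFrame q i)| ≤ M) :
    areaDensity hq a z ≤
      (2 * q - 1 + 1 : ℕ) * (M * ((2 * q - 1 + 1 : ℕ).factorial * M ^ q)) := by
  rcases ha.degenerate_or_pos with ⟨u, hu, h0⟩ | hpos
  · rw [areaDensity_of_eq_zero hq (volDensity_eq_zero ha hq hu h0)]; positivity
  · rw [areaDensity_eq_covecWedge ha hq hpos hz, covecWedge_apply]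
    set w := sharp a (dtau z)
    have hw : ∀ i, |a ![w, stdFrame q i]| ≤ M := by
      intro i
      have := sharp_spec hpos (dtau z) (-(Complex.I • stdFrame q i))
      rw [smul_neg, I_smul_I_smul, neg_neg, map_neg] at this
      rw [this, abs_neg]
      exact h2 i
    refine (le_abs_self _).trans ((Finset.abs_sum_le_sum_abs _ _).trans ?_)
    refine (Finset.sum_le_card_nsmul _ _ (M * ((2 * q - 1 + 1 : ℕ).factorial * M ^ q))
      fun i _ => ?_).trans (le_of_eq (by simp))
    rw [abs_mul, abs_pow, abs_neg, abs_one, one_pow, one_mul, abs_mul]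
    refine mul_le_mul (h3 i) ?_ (abs_nonneg _) hM
    rw [ContinuousAlternatingMap.curryLeft_apply_apply]
    set x : Fin (2 * q - 1 + 1) → Cn q := Matrix.vecCons w (i.removeNth (stdFrame q)) with hx
    have hx' : ∀ s t, s ≠ t → |a ![x s, x t]| ≤ M := by
      intro s t
      refine Fin.cases ?_ (fun s => ?_) s <;> refine Fin.cases ?_ (fun t => ?_) t
      · intro h; exact absurd rfl h
      · intro _; exact hw _
      · intro _
        rw [form_swap, abs_neg]; exact hw _
      · intro _; exact h1 _ _
    refine abs_divPow_le_of_forall _ a x _ fun σ => ?_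
    refine (Finset.prod_le_prod (fun _ _ => abs_nonneg _) fun i _ => hx' _ _ ?_).trans
      (le_of_eq (by simp : ∏ _i : Fin q, M = M ^ q))
    intro h
    have := (pairEquiv q (2 * q - 1 + 1) (by omega)).injective (σ.injective h)
    simp at this

theorem continuous_stdForm {Ω : Type*} [TopologicalSpace Ω] {h : Ω → Cn q [⋀^Fin 2]→L[ℝ] ℝ}
    (hh : Continuous h) (u v : Cn q) : Continuous fun x => h x ![u, v] :=
  (ContinuousAlternatingMap.apply ℝ (Cn q) ℝ ![u, v]).continuous.comp hh

theorem continuous_volDensity {Ω : Type*} [TopologicalSpace Ω] (hq : 1 ≤ q)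
    {h : Ω → Cn q [⋀^Fin 2]→L[ℝ] ℝ} (hh : Continuous h) :
    Continuous fun x => volDensity q hq (h x) := by
  simp only [volDensity, divPow_apply]
  refine continuous_const.mul (continuous_finsetSum _ fun σ _ => continuous_const.mul
    (continuous_finsetProd _ fun i _ => continuous_stdForm hh _ _))

theorem continuous_dtau : Continuous fun z : Cn q => dtau z := by
  rw [continuous_clm_apply]
  intro v
  simp only [dtau_apply]
  fun_prop

/-- The density is continuous on the open set where the metric is nondegenerate, and zero
elsewhere. -/
theorem measurable_areaDensity {Ω : Type*} [TopologicalSpace Ω] [MeasurableSpace Ω]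
    [BorelSpace Ω] (hq : 1 ≤ q) {h : Ω → Cn q [⋀^Fin 2]→L[ℝ] ℝ} (hh : Continuous h)
    (ha : ∀ x, IsSemiposForm (h x)) {z : Ω → Cn q} (hz : Continuous z) (hz0 : ∀ x, z x ≠ 0) :
    Measurable fun x => areaDensity hq (h x) (z x) := by
  classical
  set U : Set Ω := {x | volDensity q hq (h x) ≠ 0} with hU
  have hUo : IsOpen U := isOpen_ne_fun (continuous_volDensity hq hh) continuous_const
  have hposU : ∀ x ∈ U, ∀ u, u ≠ 0 → 0 < quad (h x) u := by
    intro x hx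
    rcases (ha x).degenerate_or_pos with ⟨u, hu, h0⟩ | hpos
    · exact absurd (volDensity_eq_zero (ha x) hq hu h0) hx
    · exact hpos
  set g : Ω → ℝ := fun x => (2 * ‖z x‖)⁻¹ * dtau (z x) ((metricCLM (h x)).inverse (dtau (z x))) *
    volDensity q hq (h x) with hg
  have hmc : Continuous fun x => metricCLM (h x) := by
    rw [continuous_clm_apply]
    intro u
    rw [continuous_clm_apply]
    intro v
    exact continuous_stdForm hh _ _
  have hdt : Continuous fun x => dtau (z x) := continuous_dtau.comp hz
  have hgU : ContinuousOn g U := by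
    intro x hx
    refine ContinuousAt.continuousWithinAt ?_
    have h1 : ContinuousAt (fun x => (metricCLM (h x)).inverse) x := by
      obtain ⟨e, he⟩ := exists_metricEquiv (hposU x hx)
      have h2 : ContinuousAt ContinuousLinearMap.inverse (metricCLM (h x)) := by
        rw [← he]
        exact (contDiffAt_map_inverse (𝕜 := ℝ) (n := 0) e).continuousAt
      exact ContinuousAt.comp (f := fun x => metricCLM (h x)) h2 hmc.continuousAt
    have h3 : ContinuousAt (fun x => (2 * ‖z x‖)⁻¹) x :=
      ((continuous_const.mul hz.norm).continuousAt).inv₀ (by simpa using hz0 x)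
    exact (h3.mul (hdt.continuousAt.clm_apply (h1.clm_apply hdt.continuousAt))).mul
      (continuous_volDensity hq hh).continuousAt
  have heq : (fun x => areaDensity hq (h x) (z x)) = U.piecewise g fun _ => 0 := by
    ext x
    by_cases hx : x ∈ U
    · rw [Set.piecewise_eq_of_mem _ _ _ hx, areaDensity_of_pos (ha x) hq (hposU x hx) (hz0 x),
        sharp_eq_inverse (hposU x hx)]
    · rw [Set.piecewise_eq_of_notMem _ _ _ hx]
      exact areaDensity_of_eq_zero hq (by simpa [hU] using hx) _
  rw [heq]
  exact hgU.measurable_piecewise continuousOn_const hUo.measurableSet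

end Metric

/-! ### Polar coordinates and Stokes' theorem on balls -/

section Polar

variable {E : Type*} [NormedAddCommGroup E] [InnerProductSpace ℝ E] [FiniteDimensional ℝ E]
  [MeasurableSpace E] [BorelSpace E] (μ : Measure E) [μ.IsAddHaarMeasure]

/-- The integral over the unit sphere of `u ↦ F (s u)`, i.e. the integral of `F` over the sphere of
radius `s` without the factor given by the power of `s`. -/
def sphereMean (F : E → ℝ) (s : ℝ) : ℝ :=
  ∫ u : Metric.sphere (0 : E) 1, F (s • (u : E)) ∂μ.toSphere

theorem continuous_sphere_integral {B : ℝ → Metric.sphere (0 : E) 1 → ℝ}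
    (hB : Continuous (Function.uncurry B)) : Continuous fun s => ∫ u, B s u ∂μ.toSphere := by
  have := continuous_parametric_integral_of_continuous (μ := μ.toSphere) hB isCompact_univ
  simpa using this

theorem continuous_sphereMean {F : E → ℝ} (hF : Continuous F) : Continuous (sphereMean μ F) := by
  refine continuous_sphere_integral μ (B := fun s u => F (s • (u : E))) ?_
  exact hF.comp (by fun_prop)

variable [Nontrivial E]

/-- Integration in polar coordinates. -/
theorem integral_polar {F : E → ℝ} (hF : Integrable F μ) :
    ∫ z, F z ∂μ = ∫ s in Ioi (0 : ℝ), s ^ (Module.finrank ℝ E - 1) * sphereMean μ F s := by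
  have hmp := μ.measurePreserving_homeomorphUnitSphereProd
  have hemb := (homeomorphUnitSphereProd E).measurableEmbedding
  let g : Metric.sphere (0 : E) 1 × Ioi (0 : ℝ) → ℝ := fun x => F (x.2.1 • x.1.1)
  have hg : ∀ x : ({(0)}ᶜ : Set E), g (homeomorphUnitSphereProd E x) = F x := by
    intro x
    have hx : ‖(x : E)‖ ≠ 0 := norm_ne_zero_iff.2 x.2
    simp only [g, homeomorphUnitSphereProd_apply_snd_coe, homeomorphUnitSphereProd_apply_fst_coe,
      smul_smul, mul_inv_cancel₀ hx, one_smul]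
  have hgi : Integrable g (μ.toSphere.prod (.volumeIoiPow (Module.finrank ℝ E - 1))) := by
    rw [← hmp.integrable_comp_emb hemb]
    have : g ∘ homeomorphUnitSphereProd E = F ∘ ((↑) : ({(0)}ᶜ : Set E) → E) := by
      ext x; exact hg x
    rw [this, ← integrableOn_iff_comap_subtypeVal (measurableSet_singleton _).compl]
    exact hF.integrableOn
  calc ∫ z, F z ∂μ = ∫ x : ({(0)}ᶜ : Set E), F x ∂(μ.comap (↑)) := by
        rw [integral_subtype_comap (measurableSet_singleton _).compl F, restrict_compl_singleton]
    _ = ∫ x : ({(0)}ᶜ : Set E), g (homeomorphUnitSphereProd E x) ∂(μ.comap (↑)) := by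
        simp only [hg]
    _ = ∫ x, g x ∂μ.toSphere.prod (.volumeIoiPow (Module.finrank ℝ E - 1)) :=
        hmp.integral_comp hemb g
    _ = ∫ s : Ioi (0 : ℝ), sphereMean μ F s ∂.volumeIoiPow (Module.finrank ℝ E - 1) :=
        integral_prod_symm g hgi
    _ = _ := by
        simp only [Measure.volumeIoiPow, ENNReal.ofReal]
        rw [integral_withDensity_eq_integral_smul,
          integral_subtype_comap measurableSet_Ioi
            fun s => Real.toNNReal (s ^ (Module.finrank ℝ E - 1)) • sphereMean μ F s,
          setIntegral_congr_fun measurableSet_Ioi fun x hx ↦ ?_]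
        · simp only [NNReal.smul_def, Real.coe_toNNReal _ (pow_nonneg hx.out.le _), smul_eq_mul]
        · exact (measurable_subtype_coe.pow_const _).real_toNNReal

theorem integral_ball_polar {F : E → ℝ} (hF : Continuous F) {t : ℝ} (ht : 0 ≤ t) :
    ∫ z in Metric.ball (0 : E) t, F z ∂μ =
      ∫ s in (0 : ℝ)..t, s ^ (Module.finrank ℝ E - 1) * sphereMean μ F s := by
  have hFi : IntegrableOn F (Metric.ball 0 t) μ :=
    (hF.continuousOn.integrableOn_compact (isCompact_closedBall (0 : E) t)).mono_set
      Metric.ball_subset_closedBall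
  rw [← integral_indicator measurableSet_ball,
    integral_polar μ (hFi.integrable_indicator measurableSet_ball),
    intervalIntegral.integral_of_le ht, ← integral_Ioc_eq_integral_Ioo' (by simp) |>.symm]
  have h : ∀ s ∈ Ioi (0 : ℝ), s ^ (Module.finrank ℝ E - 1) *
      sphereMean μ ((Metric.ball 0 t).indicator F) s =
      (Iio t).indicator (fun s => s ^ (Module.finrank ℝ E - 1) * sphereMean μ F s) s := by
    intro s hs
    have hn : ∀ u : Metric.sphere (0 : E) 1, ‖s • (u : E)‖ = s := by
      intro u; rw [norm_smul, norm_eq_of_mem_sphere, mul_one, Real.norm_of_nonneg (le_of_lt hs)]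
    by_cases hst : s < t
    · rw [indicator_of_mem (by exact hst)]
      congr 1
      refine integral_congr_ae (Eventually.of_forall fun u => ?_)
      exact indicator_of_mem (by rw [mem_ball_zero_iff, hn]; exact hst) _
    · rw [indicator_of_notMem (by exact hst)]
      have : sphereMean μ ((Metric.ball 0 t).indicator F) s = 0 := by
        rw [sphereMean]
        refine integral_eq_zero_of_ae (Eventually.of_forall fun u => ?_)
        exact indicator_of_notMem (by rw [mem_ball_zero_iff, hn]; exact hst) _
      rw [this, mul_zero]
  rw [setIntegral_congr_fun measurableSet_Ioi h, setIntegral_indicator measurableSet_Iio]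
  rfl

/-- Divergence theorem on a ball for the vector field `F • v`. It is obtained by integration by
parts against radial cut-off functions `χ(|z|)`, which in polar coordinates says that the radial
derivative of the flux through spheres, in the sense of distributions, is the spherical integral of
the divergence. -/
theorem integral_ball_fderiv {F : E → ℝ} (hF : ContDiff ℝ 1 F) (v : E) {t : ℝ} (ht : 0 < t) :
    ∫ z in Metric.ball (0 : E) t, fderiv ℝ F z v ∂μ =
      t ^ (Module.finrank ℝ E - 1) *
        ∫ u : Metric.sphere (0 : E) 1, inner ℝ (u : E) v * F (t • (u : E)) ∂μ.toSphere := by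
  set m := Module.finrank ℝ E - 1
  have hdF : Continuous fun z => fderiv ℝ F z v :=
    (hF.continuous_fderiv (by norm_num)).clm_apply continuous_const
  rw [integral_ball_polar μ hdF ht.le]
  set Q : ℝ → ℝ := fun s => s ^ m * sphereMean μ (fun z => fderiv ℝ F z v) s with hQ
  have hQc : Continuous Q := (continuous_pow m).mul (continuous_sphereMean μ hdF)
  set P : ℝ → ℝ := fun t => ∫ s in (0 : ℝ)..t, Q s with hP
  have hPd : ∀ s, HasDerivAt P (Q s) s := fun s =>
    intervalIntegral.integral_hasDerivAt_right (hQc.intervalIntegrable _ _)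
      (hQc.stronglyMeasurableAtFilter _ _) hQc.continuousAt
  have hPc : Continuous P := continuous_iff_continuousAt.2 fun s => (hPd s).continuousAt
  set S : ℝ → ℝ := fun s => s ^ m *
    ∫ u : Metric.sphere (0 : E) 1, inner ℝ (u : E) v * F (s • (u : E)) ∂μ.toSphere with hS
  have hSc : Continuous S := by
    refine (continuous_pow m).mul (continuous_sphere_integral μ
      (B := fun s u => inner ℝ (u : E) v * F (s • (u : E))) ?_)
    have h1 := hF.continuous
    exact ((continuous_subtype_val.comp continuous_snd).inner continuous_const).mul
      (h1.comp (by fun_prop))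
  change P t = S t
  -- `P` and `S` have the same distributional derivative, as seen by testing against `g = χ'`.
  have key : ∀ g : ℝ → ℝ, ContDiff ℝ ∞ g → HasCompactSupport g → tsupport g ⊆ Ioi 0 →
      ∫ s, g s • (P s - S s) = 0 := by
    intro g hg hgc hgs
    obtain ⟨δ, hδ0, hδ⟩ : ∃ δ > 0, ∀ s ≤ δ, g s = 0 := by
      have hopen : IsOpen (tsupport g)ᶜ := (isClosed_tsupport g).isOpen_compl
      obtain ⟨δ, hδ, hb⟩ := Metric.isOpen_iff.1 hopen 0 (fun h => lt_irrefl (0 : ℝ) (hgs h))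
      refine ⟨δ / 2, by positivity, fun s hs => ?_⟩
      by_cases h0 : s ≤ 0
      · exact image_eq_zero_of_notMem_tsupport fun h => absurd (hgs h) (not_lt.2 h0)
      · push Not at h0
        refine image_eq_zero_of_notMem_tsupport (hb ?_)
        rw [Metric.mem_ball, Real.dist_eq, sub_zero, abs_of_pos h0]; linarith
    obtain ⟨R, hR0, hR⟩ : ∃ R > 0, ∀ s, R ≤ s → g s = 0 := by
      obtain ⟨R, hR⟩ := hgc.isCompact.isBounded.subset_closedBall 0
      refine ⟨max R 0 + 1, by positivity, fun s hs => ?_⟩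
      refine image_eq_zero_of_notMem_tsupport fun h => ?_
      have := hR h
      rw [Metric.mem_closedBall, Real.dist_eq, sub_zero] at this
      have := le_abs_self s
      have := le_max_left R 0
      linarith
    -- `χ` is the primitive of `g` that vanishes near infinity; it is constant near `0`.
    set χ : ℝ → ℝ := fun s => ∫ x in R..s, g x with hχ
    have hχd : ∀ s, HasDerivAt χ (g s) s := fun s =>
      intervalIntegral.integral_hasDerivAt_right (hg.continuous.intervalIntegrable _ _)
        (hg.continuous.stronglyMeasurableAtFilter _ _) hg.continuous.continuousAt
    have hχR : ∀ s, R ≤ s → χ s = 0 := by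
      intro s hs
      refine intervalIntegral.integral_zero_ae (Eventually.of_forall fun x hx => ?_)
      rw [uIoc_of_le hs] at hx
      exact hR x hx.1.le
    have hχδ : ∀ s ≤ δ, χ s = χ 0 := by
      intro s hs
      have h1 : χ s = χ 0 + ∫ x in (0 : ℝ)..s, g x :=
        (intervalIntegral.integral_add_adjacent_intervals
          (hg.continuous.intervalIntegrable _ _) (hg.continuous.intervalIntegrable _ _)).symm
      rw [h1, intervalIntegral.integral_zero_ae, add_zero]
      refine Eventually.of_forall fun x hx => hδ x ?_
      exact hx.2.trans (max_le hδ0.le hs)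
    have hχ1 : ContDiff ℝ 1 χ := by
      rw [contDiff_one_iff_deriv]
      refine ⟨fun s => (hχd s).differentiableAt, ?_⟩
      have : deriv χ = g := funext fun s => (hχd s).deriv
      rw [this]; exact hg.continuous
    set Χ : E → ℝ := fun z => χ ‖z‖ with hX
    have hX1 : ContDiff ℝ 1 Χ := by
      rw [contDiff_iff_contDiffAt]
      intro z
      by_cases hz : z = 0
      · have : Χ =ᶠ[𝓝 z] fun _ => χ 0 := by
          have : Metric.ball (0 : E) δ ∈ 𝓝 z := by rw [hz]; exact Metric.ball_mem_nhds _ hδ0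
          filter_upwards [this] with w hw
          exact hχδ _ (by simpa using (mem_ball_zero_iff.1 hw).le)
        exact contDiffAt_const.congr_of_eventuallyEq this
      · exact hχ1.contDiffAt.comp z (contDiffAt_norm ℝ hz)
    have hXs : ∀ z, z ∉ Metric.closedBall (0 : E) R → Χ z = 0 := by
      intro z hz
      exact hχR _ (by simpa using (not_le.1 (fun h => hz (mem_closedBall_zero_iff.2 h))).le)
    have hXc : HasCompactSupport Χ := HasCompactSupport.intro (isCompact_closedBall 0 R) hXs
    have hdX : Continuous fun z => fderiv ℝ Χ z v :=
      (hX1.continuous_fderiv (by norm_num)).clm_apply continuous_const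
    have i1 : Integrable (fun z => fderiv ℝ Χ z v * F z) μ :=
      (hdX.mul hF.continuous).integrable_of_hasCompactSupport
        (HasCompactSupport.mul_right (hXc.fderiv_apply ℝ v))
    have i2 : Integrable (fun z => Χ z * fderiv ℝ F z v) μ :=
      (hX1.continuous.mul hdF).integrable_of_hasCompactSupport hXc.mul_right
    have i3 : Integrable (fun z => Χ z * F z) μ :=
      (hX1.continuous.mul hF.continuous).integrable_of_hasCompactSupport hXc.mul_right
    have hibp := integral_mul_fderiv_eq_neg_fderiv_mul_of_integrable i1 i2 i3
      (fun z _ => hX1.differentiable (by norm_num) z)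
      (fun z _ => hF.differentiable (by norm_num) z)
    rw [integral_polar μ i1, integral_polar μ i2] at hibp
    have hn : ∀ s ∈ Ioi (0 : ℝ), ∀ u : Metric.sphere (0 : E) 1, ‖s • (u : E)‖ = s := by
      intro s hs u
      rw [norm_smul, norm_eq_of_mem_sphere, mul_one, Real.norm_of_nonneg (le_of_lt hs)]
    have e1 : ∀ s ∈ Ioi (0 : ℝ), s ^ m * sphereMean μ (fun z => Χ z * fderiv ℝ F z v) s =
        χ s * Q s := by
      intro s hs
      simp only [sphereMean, hX, hn s hs, integral_const_mul, hQ]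
      ring
    have e2 : ∀ s ∈ Ioi (0 : ℝ), s ^ m * sphereMean μ (fun z => fderiv ℝ Χ z v * F z) s =
        g s * S s := by
      intro s hs
      have hs0 : s ≠ 0 := ne_of_gt hs
      have h1 : ∀ u : Metric.sphere (0 : E) 1, fderiv ℝ Χ (s • (u : E)) v =
          g s * inner ℝ (u : E) v := by
        intro u
        have hne : s • (u : E) ≠ 0 := by
          rw [← norm_ne_zero_iff, hn s hs]; exact hs0
        have h2 := (hasStrictFDerivAt_norm_sq (s • (u : E))).hasFDerivAt.sqrt
          (by simpa using hne)
        have h3 : (fun w : E => √(‖w‖ ^ 2)) = fun w => ‖w‖ := by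
          ext w; exact Real.sqrt_sq (norm_nonneg _)
        rw [h3] at h2
        have h4 := (hχd ‖s • (u : E)‖).comp_hasFDerivAt (s • (u : E)) h2
        have h5 : fderiv ℝ Χ (s • (u : E)) = _ := h4.fderiv
        rw [h5, Real.sqrt_sq (norm_nonneg _), hn s hs]
        simp
        field_simp
        simp
      simp only [sphereMean, h1, hS, mul_assoc, integral_const_mul]
      ring
    rw [setIntegral_congr_fun measurableSet_Ioi e1, setIntegral_congr_fun measurableSet_Ioi e2]
      at hibp
    have hIoi : ∀ f : ℝ → ℝ, (∀ s, R ≤ s → f s = 0) →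
        ∫ s in Ioi (0 : ℝ), f s = ∫ s in (0 : ℝ)..R, f s := by
      intro f hf
      rw [intervalIntegral.integral_of_le hR0.le]
      refine setIntegral_eq_of_subset_of_forall_sdiff_eq_zero measurableSet_Ioi
        (fun x hx => hx.1) fun x hx => hf x ?_
      by_contra h
      exact hx.2 ⟨hx.1, (not_le.1 h).le⟩
    rw [hIoi _ fun s hs => by rw [hχR s hs, zero_mul],
      hIoi _ fun s hs => by rw [hR s hs, zero_mul]] at hibp
    have hparts := intervalIntegral.integral_mul_deriv_eq_deriv_mul (a := 0) (b := R)
      (fun s _ => hχd s) (fun s _ => hPd s) (hg.continuous.intervalIntegrable _ _)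
      (hQc.intervalIntegrable _ _)
    have hP0 : P 0 = 0 := intervalIntegral.integral_same
    rw [hχR R le_rfl, hP0, hibp] at hparts
    have hwhole : ∫ s, g s • (P s - S s) = ∫ s in Ioi (0 : ℝ), g s • (P s - S s) := by
      refine (setIntegral_eq_integral_of_forall_compl_eq_zero fun s hs => ?_).symm
      rw [hδ s ((not_lt.1 hs).trans hδ0.le), zero_smul]
    rw [hwhole, hIoi _ fun s hs => by rw [hR s hs, zero_smul]]
    simp only [smul_eq_mul, mul_sub]
    rw [intervalIntegral.integral_sub (f := fun s => g s * P s) (g := fun s => g s * S s)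
      ((hg.continuous.mul hPc).intervalIntegrable _ _)
      ((hg.continuous.mul hSc).intervalIntegrable _ _)]
    linarith
  have hae := isOpen_Ioi.ae_eq_zero_of_integral_contDiff_smul_eq_zero (μ := volume)
    ((hPc.sub hSc).locallyIntegrable.locallyIntegrableOn _) key
  have heq : EqOn (fun s => P s - S s) (fun _ => 0) (Ioi 0) :=
    Measure.eqOn_open_of_ae_eq (μ := volume)
      ((ae_restrict_iff' measurableSet_Ioi).2 hae)
      isOpen_Ioi (hPc.sub hSc).continuousOn continuousOn_const
  exact sub_eq_zero.1 (heq ht)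

end Polar

section Stokes

variable {q : ℕ}

theorem finrank_real_Cn (q : ℕ) : Module.finrank ℝ (Cn q) = 2 * q := by
  rw [finrank_real_of_complex]; simp

theorem dr_apply_smul {s : ℝ} (hs : 0 < s) (u : Metric.sphere (0 : Cn q) 1) (v : Cn q) :
    dr (s • (u : Cn q)) v = inner ℝ (u : Cn q) v := by
  have hn : ‖s • (u : Cn q)‖ = s := by
    rw [norm_smul, norm_eq_of_mem_sphere, mul_one, Real.norm_of_nonneg hs.le]
  have hne : s • (u : Cn q) ≠ 0 := by
    rw [← norm_ne_zero_iff, hn]; exact hs.ne'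
  rw [dr_eq _ hne, smul_apply, dtau_apply, hn, real_inner_smul_left, smul_eq_mul]
  field_simp

/-- Stokes' theorem on balls of `ℂ^q`. -/
theorem ballIntegral_extDeriv (hq : 1 ≤ q) {α : DiffForm (Cn q) (Cn q) (2 * q - 1)}
    (hα : ∀ v, ContDiff ℝ 1 fun z => α z v) (hα' : Differentiable ℝ α) {t : ℝ} (ht : 0 < t) :
    ballIntegral t (fun z => extDeriv α z) = sphereIntegral t α := by
  have : Nonempty (Fin q) := ⟨⟨0, hq⟩⟩
  have hF : ∀ i : Fin (2 * q - 1 + 1), ContDiff ℝ 1 fun z => α z (i.removeNth (stdFrame q)) :=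
    fun i => hα _
  have hdim : Module.finrank ℝ (Cn q) - 1 = 2 * q - 1 := by rw [finrank_real_Cn]
  rw [ballIntegral, sphereIntegral]
  have h1 : ∀ z, extDeriv α z (stdFrame q) = ∑ i : Fin (2 * q - 1 + 1), (-1) ^ (i : ℕ) *
      fderiv ℝ (fun z => α z (i.removeNth (stdFrame q))) z (stdFrame q i) := by
    intro z
    rw [extDeriv_apply (hα' z)]
    simp
  have hc : ∀ i : Fin (2 * q - 1 + 1), Continuous fun z =>
      fderiv ℝ (fun z => α z (i.removeNth (stdFrame q))) z (stdFrame q i) :=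
    fun i => ((hF i).continuous_fderiv (by norm_num)).clm_apply continuous_const
  simp only [h1]
  rw [integral_finsetSum]
  · simp only [covecWedge_apply, dr_apply_smul ht]
    rw [integral_finsetSum, Finset.mul_sum]
    · refine Finset.sum_congr rfl fun i _ => ?_
      rw [integral_const_mul, integral_const_mul, integral_ball_fderiv volume (hF i) _ ht, hdim]
      ring
    · intro i _
      have : Continuous fun u : Metric.sphere (0 : Cn q) 1 => (-1 : ℝ) ^ (i : ℕ) *
          (inner ℝ (u : Cn q) (stdFrame q i) *
            (α (t • (u : Cn q))) (i.removeNth (stdFrame q))) := by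
        have h2 := (hF i).continuous
        exact continuous_const.mul ((continuous_subtype_val.inner continuous_const).mul
          (h2.comp (by fun_prop)))
      have h3 := this.continuousOn.integrableOn_compact
        (μ := (volume : Measure (Cn q)).toSphere) isCompact_univ
      simpa using h3
  · intro i _
    exact ((continuous_const.mul (hc i)).continuousOn.integrableOn_compact
      (isCompact_closedBall (0 : Cn q) t)).mono_set Metric.ball_subset_closedBall

end Stokes

/-! ### Pullbacks, holomorphic lifts and comparison of metrics -/

section Pullback

variable {W : Type*} [NormedAddCommGroup W] [NormedSpace ℂ W]
  {V : Type*} [NormedAddCommGroup V] [NormedSpace ℂ V]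
  {V' : Type*} [NormedAddCommGroup V'] [NormedSpace ℂ V']
  {N : Type*} [TopologicalSpace N] [ChartedSpace W N]
  {X : Type*} [TopologicalSpace X] [ChartedSpace V X]
  {X' : Type*} [TopologicalSpace X'] [ChartedSpace V' X']

theorem diff_comp {g : X → X'} {f : N → X} {z : N}
    (hg : MDifferentiableAt 𝓘(ℂ, V) 𝓘(ℂ, V') g (f z))
    (hf : MDifferentiableAt 𝓘(ℂ, W) 𝓘(ℂ, V) f z) :
    diff (g ∘ f) z = (diff g (f z) : V →L[ℂ] V').comp (diff f z : W →L[ℂ] V) :=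
  mfderiv_comp z hg hf

theorem diff_congr {f f' : N → X} {z : N} (h : f =ᶠ[𝓝 z] f') :
    (diff f z : W →L[ℂ] V) = diff f' z :=
  Filter.EventuallyEq.mfderiv_eq h

theorem diff_eq_fderiv (f : W → V) (z : W) : (diff f z : W →L[ℂ] V) = fderiv ℂ f z :=
  mfderiv_eq_fderiv

theorem diff_id (z : N) : (diff (fun x : N => x) z : W →L[ℂ] W) = ContinuousLinearMap.id ℂ W :=
  mfderiv_id

theorem pullback_apply {k : ℕ} (f : N → X) (α : DiffForm V X k) (z : N) (v : Fin k → W) :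
    pullback f α z v = α (f z) fun i => (diff f z : W →L[ℂ] V) (v i) := rfl

theorem pullback_comp {k : ℕ} {g : X → X'} {f : N → X} {z : N} (α : DiffForm V' X' k)
    (hg : MDifferentiableAt 𝓘(ℂ, V) 𝓘(ℂ, V') g (f z))
    (hf : MDifferentiableAt 𝓘(ℂ, W) 𝓘(ℂ, V) f z) :
    (pullback (g ∘ f) α : DiffForm W N k) z = pullback f (pullback g α : DiffForm V X k) z := by
  ext v
  rw [pullback_apply, pullback_apply, pullback_apply, diff_comp hg hf]
  rfl

theorem pullback_congr {k : ℕ} {f f' : N → X} {z : N} (α : DiffForm V X k) (h : f =ᶠ[𝓝 z] f') :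
    (pullback f α : DiffForm W N k) z = pullback f' α z := by
  ext v
  rw [pullback_apply, pullback_apply, diff_congr h, h.eq_of_nhds]

theorem quad_smul (a : V [⋀^Fin 2]→L[ℝ] ℝ) (c : ℝ) (u : V) : quad a (c • u) = c ^ 2 * quad a u := by
  rw [quad, quad, smul_comm, form_smul_left, form_smul_right]; ring

theorem IsHermitianMetric.isSemiposForm {γ : DiffForm V X 2} (h : IsHermitianMetric γ) (x : X) :
    IsSemiposForm (γ x) where
  oneOne := h.oneOne x
  nonneg u := by
    by_cases hu : u = 0
    · have := quad_smul (γ x) 0 (0 : V)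
      rw [hu]; simp at this; rw [this]
    · exact (h.pos x u hu).le


variable {p : ℕ}

theorem quad_pullback (f : N → X) (γ : DiffForm V X 2) (z : N)
    (u : W) : quad (pullback (W := W) f γ z) u = quad (γ (f z)) ((diff f z : W →L[ℂ] V) u) :=
  quad_comp _ _ _

theorem contDiffAt_pullback_chart {k : ℕ} {α : DiffForm V X k} (hα : IsSmoothForm α) (x : X) :
    ContDiffAt ℝ ∞ (pullback (W := V) (chartAt V x).symm α : DiffForm V V k) (chartAt V x x) :=
  (hα _ (chart_mem_atlas V x)).contDiffAt
    ((chartAt V x).open_target.mem_nhds (mem_chart_target V x))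

variable [IsManifold 𝓘(ℂ, V) ω X]

theorem mdiff_chart {x₀ x : X} (hx : x ∈ (chartAt V x₀).source) :
    MDifferentiableAt 𝓘(ℂ, V) 𝓘(ℂ, V) (chartAt V x₀) x :=
  mdifferentiableAt_atlas (chart_mem_atlas V x₀) hx

theorem mdiff_chart_symm {x₀ : X} {y : V} (hy : y ∈ (chartAt V x₀).target) :
    MDifferentiableAt 𝓘(ℂ, V) 𝓘(ℂ, V) (chartAt V x₀).symm y :=
  mdifferentiableAt_atlas_symm (chart_mem_atlas V x₀) hy

theorem diff_chart_symm_comp {x₀ x : X} (hx : x ∈ (chartAt V x₀).source) (u : V) :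
    (diff (W := V) (V := V) (chartAt V x₀).symm (chartAt V x₀ x) : V →L[ℂ] V)
      ((diff (W := V) (V := V) (chartAt V x₀) x : V →L[ℂ] V) u) = u := by
  have h1 := diff_comp (mdiff_chart_symm ((chartAt V x₀).map_source hx)) (mdiff_chart hx)
  have h2 : (chartAt V x₀).symm ∘ chartAt V x₀ =ᶠ[𝓝 x] fun x => x := by
    filter_upwards [(chartAt V x₀).open_source.mem_nhds hx] with y hy
    exact (chartAt V x₀).left_inv hy
  rw [diff_congr h2, diff_id] at h1
  exact (congrArg (fun A : V →L[ℂ] V => A u) h1).symm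

theorem diff_chart_comp_symm {x₀ : X} {y : V} (hy : y ∈ (chartAt V x₀).target) (u : V) :
    (diff (W := V) (V := V) (chartAt V x₀) ((chartAt V x₀).symm y) : V →L[ℂ] V)
      ((diff (W := V) (V := V) (chartAt V x₀).symm y : V →L[ℂ] V) u) = u := by
  have h1 := diff_comp (mdiff_chart ((chartAt V x₀).map_target hy)) (mdiff_chart_symm hy)
  have h2 : chartAt V x₀ ∘ (chartAt V x₀).symm =ᶠ[𝓝 y] fun x => x := by
    filter_upwards [(chartAt V x₀).open_target.mem_nhds hy] with y hy
    exact (chartAt V x₀).right_inv hy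
  rw [diff_congr h2, diff_id] at h1
  exact (congrArg (fun A : V →L[ℂ] V => A u) h1).symm

/-- Near `z`, the pullback of a form under `f` is computed from its expression in the preferred
chart at `f z`. -/
theorem pullback_eventuallyEq {k : ℕ} {f : W → X} (hf : MDifferentiable 𝓘(ℂ, W) 𝓘(ℂ, V) f)
    (α : DiffForm V X k) (z : W) :
    (pullback f α : DiffForm W W k) =ᶠ[𝓝 z] fun w =>
      ((pullback (W := V) (chartAt V (f z)).symm α : DiffForm V V k)
        ((chartAt V (f z) ∘ f) w)).compContinuousLinearMap
        ((fderiv ℂ (chartAt V (f z) ∘ f) w).restrictScalars ℝ) := by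
  have hU : f ⁻¹' (chartAt V (f z)).source ∈ 𝓝 z :=
    hf.continuous.continuousAt.preimage_mem_nhds
      ((chartAt V (f z)).open_source.mem_nhds (mem_chart_source V (f z)))
  filter_upwards [eventually_mem_nhds_iff.2 hU] with w hw
  have hw' : w ∈ f ⁻¹' (chartAt V (f z)).source := mem_of_mem_nhds hw
  have h1 : f =ᶠ[𝓝 w] (chartAt V (f z)).symm ∘ (chartAt V (f z) ∘ f) := by
    filter_upwards [hw] with w' hw'
    exact ((chartAt V (f z)).left_inv hw').symm
  have h2 : MDifferentiableAt 𝓘(ℂ, W) 𝓘(ℂ, V) (chartAt V (f z) ∘ f) w :=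
    (mdiff_chart hw').comp w (hf w)
  rw [pullback_congr α h1,
    pullback_comp (g := (chartAt V (f z)).symm) (f := chartAt V (f z) ∘ f) α
      (mdiff_chart_symm ((chartAt V (f z)).map_source hw')) h2]
  ext v
  rw [pullback_apply, diff_eq_fderiv]
  rfl

theorem contDiffAt_chart_comp {f : W → X} (hf : ContMDiff 𝓘(ℂ, W) 𝓘(ℂ, V) ω f) (z : W) :
    ContDiffAt ℂ ω (chartAt V (f z) ∘ f) z := by
  rw [← contMDiffAt_iff_contDiffAt]
  exact (contMDiffAt_of_mem_maximalAtlas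
    (IsManifold.chart_mem_maximalAtlas (f z)) (mem_chart_source V (f z))).comp z (hf z)

theorem contDiffAt_fderiv_chart_comp {f : W → X} (hf : ContMDiff 𝓘(ℂ, W) 𝓘(ℂ, V) ω f) (z : W) :
    ContDiffAt ℝ 1 (fun w => (fderiv ℂ (chartAt V (f z) ∘ f) w).restrictScalars ℝ) z := by
  have h1 : ContDiffAt ℂ 1 (fderiv ℂ (chartAt V (f z) ∘ f)) z :=
    ((contDiffAt_chart_comp hf z).of_le (m := 2) le_top).fderiv_right (by norm_num)
  exact (ContinuousLinearMap.restrictScalarsL ℂ W V ℝ ℝ).contDiff.contDiffAt.comp z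
    (h1.restrict_scalars ℝ)

theorem continuous_pullback {k : ℕ} {f : W → X} (hf : ContMDiff 𝓘(ℂ, W) 𝓘(ℂ, V) ω f)
    {α : DiffForm V X k} (hα : IsSmoothForm α) : Continuous (pullback f α : DiffForm W W k) := by
  rw [continuous_iff_continuousAt]
  intro z
  refine ContinuousAt.congr ?_ (pullback_eventuallyEq (hf.mdifferentiable (by simp)) α z).symm
  have h1 := (contDiffAt_pullback_chart hα (f z)).continuousAt
  have h2 := (contDiffAt_chart_comp hf z).continuousAt
  have h3 : ContinuousAt (fun w => (pullback (W := V) (chartAt V (f z)).symm α : DiffForm V V k)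
    ((chartAt V (f z) ∘ f) w)) z := ContinuousAt.comp (f := chartAt V (f z) ∘ f) h1 h2
  have h4 := (contDiffAt_fderiv_chart_comp hf z).continuousAt
  have h5 := (ContinuousAlternatingMap.continuous_compContinuousLinearMapCLM (𝕜 := ℝ) (E := W)
    (F := V) (G := ℝ) (ι := Fin k)).continuousAt.comp h4
  exact h5.clm_apply h3

theorem differentiable_pullback {k : ℕ} {f : W → X} (hf : ContMDiff 𝓘(ℂ, W) 𝓘(ℂ, V) ω f)
    {α : DiffForm V X k} (hα : IsSmoothForm α) :
    Differentiable ℝ (pullback f α : DiffForm W W k) := by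
  intro z
  refine DifferentiableAt.congr_of_eventuallyEq ?_
    (pullback_eventuallyEq (hf.mdifferentiable (by simp)) α z)
  have h1 := (contDiffAt_pullback_chart hα (f z)).differentiableAt (by simp)
  have h2 := ((contDiffAt_chart_comp hf z).restrict_scalars ℝ).differentiableAt (by simp)
  have h4 := (contDiffAt_fderiv_chart_comp hf z).differentiableAt (by simp)
  exact DifferentiableAt.continuousAlternatingMapCompContinuousLinearMap
    (DifferentiableAt.comp (f := chartAt V (f z) ∘ f) z h1 h2) h4

theorem contDiff_pullback_apply {k : ℕ} {f : W → X} (hf : ContMDiff 𝓘(ℂ, W) 𝓘(ℂ, V) ω f)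
    {α : DiffForm V X k} (hα : IsSmoothForm α) (v : Fin k → W) :
    ContDiff ℝ 1 fun z => (pullback f α : DiffForm W W k) z v := by
  rw [contDiff_iff_contDiffAt]
  intro z
  have h0 := pullback_eventuallyEq (hf.mdifferentiable (by simp)) α z
  refine ContDiffAt.congr_of_eventuallyEq ?_ (h0.mono fun w hw => congrArg (fun β => β v) hw)
  have h1 := (contDiffAt_pullback_chart hα (f z)).of_le (m := 1) (by simp)
  have h2 := ((contDiffAt_chart_comp hf z).restrict_scalars ℝ).of_le (m := 1) le_top
  have h12 : ContDiffAt ℝ 1 (fun w => (pullback (W := V) (chartAt V (f z)).symm α :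
    DiffForm V V k) ((chartAt V (f z) ∘ f) w)) z :=
    ContDiffAt.comp (f := chartAt V (f z) ∘ f) z h1 h2
  let T : (V [⋀^Fin k]→L[ℝ] ℝ) →L[ℝ] ContinuousMultilinearMap ℝ (fun _ : Fin k => V) ℝ :=
    ContinuousAlternatingMap.toContinuousMultilinearMapCLM ℝ
  have h3 : ContDiffAt ℝ 1 (fun w => T ((pullback (W := V) (chartAt V (f z)).symm α :
    DiffForm V V k) ((chartAt V (f z) ∘ f) w))) z := T.contDiff.contDiffAt.comp z h12
  have h4 := contDiffAt_fderiv_chart_comp hf z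
  have h5 : ContDiffAt ℝ 1 (fun w =>
      ContinuousMultilinearMap.compContinuousLinearMapContinuousMultilinear ℝ
        (fun _ : Fin k => W) (fun _ => V) ℝ
        (fun _ => (fderiv ℂ (chartAt V (f z) ∘ f) w).restrictScalars ℝ)) z :=
    (ContinuousMultilinearMap.contDiff _).contDiffAt.comp z (contDiffAt_pi.2 fun _ => h4)
  exact (ContinuousMultilinearMap.apply ℝ (fun _ : Fin k => W) ℝ v).contDiff.contDiffAt.comp z
    (h5.clm_apply h3)

/-- The exterior derivative commutes with pullback under holomorphic maps from a vector space. -/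
theorem pullback_extD {k : ℕ} {f : W → X} (hf : ContMDiff 𝓘(ℂ, W) 𝓘(ℂ, V) ω f)
    {α : DiffForm V X k} (hα : IsSmoothForm α) (z : W) :
    (pullback f (extD α) : DiffForm W W (k + 1)) z = extDeriv (pullback f α) z := by
  have hmd := hf.mdifferentiable (n := ω) (by simp)
  have hdiff : ∀ᶠ w in 𝓝 z, DifferentiableAt ℂ (chartAt V (f z) ∘ f) w :=
    (((contDiffAt_chart_comp hf z).of_le (m := 1) le_top).eventually (by simp)).mono
      fun w hw => hw.differentiableAt (by simp)
  have h0 : (pullback f α : DiffForm W W k) =ᶠ[𝓝 z] fun w =>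
      ((pullback (W := V) (chartAt V (f z)).symm α : DiffForm V V k)
        ((chartAt V (f z) ∘ f) w)).compContinuousLinearMap
        (fderiv ℝ (chartAt V (f z) ∘ f) w) := by
    filter_upwards [pullback_eventuallyEq hmd α z, hdiff] with w hw hw'
    rw [hw, hw'.fderiv_restrictScalars ℝ]
  rw [h0.extDeriv_eq, extDeriv_pullback (f := chartAt V (f z) ∘ f)
    ((contDiffAt_pullback_chart hα (f z)).differentiableAt (by simp))
    ((contDiffAt_chart_comp hf z).restrict_scalars ℝ) (by simp),
    hdiff.self_of_nhds.fderiv_restrictScalars ℝ, ← diff_eq_fderiv,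
    diff_comp (mdiff_chart (mem_chart_source V (f z))) (hmd z)]
  rfl

end Pullback

section Lift

variable {W : Type*} [NormedAddCommGroup W] [NormedSpace ℂ W]
  {V : Type*} [NormedAddCommGroup V] [NormedSpace ℂ V]
  {Y : Type*} [TopologicalSpace Y] [ChartedSpace V Y]
  {X : Type*} [TopologicalSpace X] [ChartedSpace V X] {π : Y → X}

/-- A covering map in the sense of Mathlib may have empty fibres, but not over a connected base. -/
theorem surjective_of_isCoveringMap {Y X : Type*} [TopologicalSpace Y] [TopologicalSpace X]
    [Nonempty Y] [PreconnectedSpace X] {π : Y → X} (h : IsCoveringMap π) :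
    Function.Surjective π := by
  rw [← range_eq_univ]
  refine IsClopen.eq_univ ⟨?_, h.isOpenMap.isOpen_range⟩ (range_nonempty π)
  rw [← isOpen_compl_iff, isOpen_iff_mem_nhds]
  intro x hx
  obtain ⟨-, U, hxU, hU, -, e, he⟩ := h x
  have : IsEmpty (π ⁻¹' {x}) := ⟨fun y => hx ⟨y, y.2⟩⟩
  filter_upwards [hU.mem_nhds hxU] with x' hx' ⟨y, hy⟩
  exact this.elim (e ⟨y, by rw [mem_preimage, hy]; exact hx'⟩).2

/-- Holomorphic maps from a vector space lift to the universal cover; the lift is holomorphic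
because the covering is locally biholomorphic. -/
theorem exists_holomorphic_lift [ConnectedSpace X] (hπ : IsUniversalCover V π) {f : W → X}
    (hf : ContMDiff 𝓘(ℂ, W) 𝓘(ℂ, V) ω f) :
    ∃ F : W → Y, ContMDiff 𝓘(ℂ, W) 𝓘(ℂ, V) ω F ∧ π ∘ F = f := by
  have := hπ.simplyConnected
  let _ : NormedSpace ℝ W := NormedSpace.complexToReal
  have : LocallyPathConnectedSpace W := inferInstance
  have : SimplyConnectedSpace W := inferInstance
  obtain ⟨y₀, hy₀⟩ := surjective_of_isCoveringMap hπ.covering (f 0)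
  obtain ⟨F, ⟨-, hF⟩, -⟩ := hπ.covering.existsUnique_continuousMap_lifts ⟨f, hf.continuous⟩ 0 y₀ hy₀
  have hF' : ∀ z, π (F z) = f z := fun z => congrFun hF z
  refine ⟨F, fun z => ?_, hF⟩
  obtain ⟨Φ, hz, hΦ⟩ := hπ.localBiholomorphic (F z)
  have h1 : (F : W → Y) =ᶠ[𝓝 z] Φ.symm ∘ f := by
    have : F ⁻¹' Φ.source ∈ 𝓝 z :=
      F.continuous.continuousAt.preimage_mem_nhds (Φ.open_source.mem_nhds hz)
    filter_upwards [this] with w hw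
    rw [Function.comp_apply, ← hF' w, hΦ hw]
    exact (Φ.left_inv hw).symm
  refine ContMDiffAt.congr_of_eventuallyEq ?_ h1
  have h2 : f z ∈ Φ.target := by
    rw [← hF' z, hΦ hz]; exact Φ.map_source hz
  exact ContMDiffAt.comp z
    (Φ.symm.contMDiffOn.contMDiffAt (Φ.open_target.mem_nhds h2)) (hf z)

end Lift

section Compare

variable {V : Type*} [NormedAddCommGroup V] [NormedSpace ℂ V] [FiniteDimensional ℂ V]
  {X : Type*} [TopologicalSpace X] [ChartedSpace V X] [IsManifold 𝓘(ℂ, V) ω X]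

/-- Local comparison of two metrics. It is carried out in one fixed chart, as the identification of
`T_x X` with `V` by the preferred chart at `x` does not depend continuously on `x`. -/
theorem quad_le_near {γ γ' : DiffForm V X 2} (hγ : IsHermitianMetric γ)
    (hγ' : IsHermitianMetric γ') (x₀ : X) :
    ∃ U ∈ 𝓝 x₀, ∃ C : ℝ, 0 ≤ C ∧ ∀ x ∈ U, ∀ u : V, quad (γ' x) u ≤ C * quad (γ x) u := by
  have : ProperSpace V := FiniteDimensional.proper ℂ V
  set φ := chartAt V x₀ with hφ
  set A : DiffForm V V 2 := pullback (W := V) φ.symm γ with hA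
  set A' : DiffForm V V 2 := pullback (W := V) φ.symm γ' with hA'
  have hAc : ContinuousOn A φ.target := (hγ.smooth φ (chart_mem_atlas V x₀)).continuousOn
  have hAc' : ContinuousOn A' φ.target := (hγ'.smooth φ (chart_mem_atlas V x₀)).continuousOn
  obtain ⟨ε, hε, hball⟩ := Metric.nhds_basis_closedBall.mem_iff.1
    (φ.open_target.mem_nhds (mem_chart_target V x₀))
  set K := Metric.closedBall (φ x₀) ε ×ˢ Metric.sphere (0 : V) 1 with hK
  have hKc : IsCompact K := (isCompact_closedBall _ _).prod (isCompact_sphere _ _)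
  have hq : ∀ B : DiffForm V V 2, ContinuousOn B φ.target →
      ContinuousOn (fun x : V × V => quad (B x.1) x.2) K := by
    intro B hB
    have h1 : ContinuousOn (fun x : V × V => B x.1) K :=
      hB.comp continuousOn_fst fun x hx => hball hx.1
    have h2 : Continuous fun x : V × V => (![x.2, Complex.I • x.2] : Fin 2 → V) := by
      refine continuous_pi fun j => ?_
      fin_cases j
      · exact continuous_snd
      · exact continuous_snd.const_smul _
    have h3 : Continuous fun p : (V [⋀^Fin 2]→L[ℝ] ℝ) × (Fin 2 → V) => p.1 p.2 :=
      continuous_eval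
    exact h3.comp_continuousOn (h1.prodMk h2.continuousOn)
  have hpos : ∀ x ∈ K, 0 < quad (A x.1) x.2 := by
    intro x hx
    rw [hA, quad_pullback]
    refine hγ.pos _ _ fun h0 => ?_
    have h1 := diff_chart_comp_symm (x₀ := x₀) (hball hx.1) x.2
    rw [← hφ, h0, map_zero] at h1
    have h2 := mem_sphere_zero_iff_norm.1 hx.2
    rw [← h1, norm_zero] at h2
    exact zero_ne_one h2
  obtain ⟨C, hC⟩ := (hKc.image_of_continuousOn
    ((hq A' hAc').div (hq A hAc) fun x hx => (hpos x hx).ne')).bddAbove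
  have hle : ∀ y ∈ Metric.closedBall (φ x₀) ε, ∀ u : V,
      quad (A' y) u ≤ max C 0 * quad (A y) u := by
    intro y hy u
    by_cases hu : u = 0
    · simp only [hu, quad, smul_zero]
      have h0 : (![0, 0] : Fin 2 → V) = 0 := by ext i; fin_cases i <;> rfl
      rw [h0, ContinuousAlternatingMap.map_zero, ContinuousAlternatingMap.map_zero, mul_zero]
    · have hu' : ‖u‖ ≠ 0 := norm_ne_zero_iff.2 hu
      have hmem : (y, ‖u‖⁻¹ • u) ∈ K := by
        refine ⟨hy, ?_⟩
        rw [mem_sphere_zero_iff_norm, norm_smul, norm_inv, norm_norm, inv_mul_cancel₀ hu']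
      have h1 := hC ⟨_, hmem, rfl⟩
      rw [Pi.div_apply, div_le_iff₀ (hpos _ hmem)] at h1
      have h2 := h1.trans (mul_le_mul_of_nonneg_right (le_max_left C 0) (hpos _ hmem).le)
      simp only [quad_smul] at h2
      have h3 : 0 < (‖u‖⁻¹) ^ 2 := by positivity
      refine le_of_mul_le_mul_left ?_ h3
      linarith
  refine ⟨φ.source ∩ φ ⁻¹' Metric.ball (φ x₀) ε, ?_, max C 0, le_max_right _ _, ?_⟩
  · exact (φ.isOpen_inter_preimage Metric.isOpen_ball).mem_nhds
      ⟨mem_chart_source V x₀, Metric.mem_ball_self hε⟩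
  · intro x hx u
    have h1 := hle (φ x) (Metric.ball_subset_closedBall hx.2)
      ((diff (W := V) (V := V) φ x : V →L[ℂ] V) u)
    rw [hA, hA', quad_pullback, quad_pullback, φ.left_inv hx.1,
      diff_chart_symm_comp hx.1] at h1
    exact h1

/-- Any two Hermitian metrics on a compact complex manifold are comparable. -/
theorem exists_quad_le [CompactSpace X] {γ γ' : DiffForm V X 2} (hγ : IsHermitianMetric γ)
    (hγ' : IsHermitianMetric γ') :
    ∃ C : ℝ, 0 ≤ C ∧ ∀ (x : X) (u : V), quad (γ' x) u ≤ C * quad (γ x) u := by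
  have hnn : ∀ x (u : V), 0 ≤ quad (γ x) u := fun x => (hγ.isSemiposForm x).nonneg
  have := isCompact_univ.induction_on (X := X)
    (p := fun s => ∃ C : ℝ, 0 ≤ C ∧ ∀ x ∈ s, ∀ u : V, quad (γ' x) u ≤ C * quad (γ x) u)
    ⟨0, le_rfl, fun x hx => absurd hx (notMem_empty x)⟩
    (fun s t hst ⟨C, hC, h⟩ => ⟨C, hC, fun x hx => h x (hst hx)⟩)
    (fun s t ⟨C, hC, h⟩ ⟨C', hC', h'⟩ => by
      refine ⟨C + C', add_nonneg hC hC', fun x hx u => ?_⟩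
      rw [add_mul]
      rcases hx with hx | hx
      · exact (h x hx u).trans (le_add_of_nonneg_right (mul_nonneg hC' (hnn x u)))
      · exact (h' x hx u).trans (le_add_of_nonneg_left (mul_nonneg hC (hnn x u))))
    (fun x _ => by
      obtain ⟨U, hU, h⟩ := quad_le_near hγ hγ' x
      exact ⟨U, mem_nhdsWithin_of_mem_nhds hU, h⟩)
  obtain ⟨C, hC, h⟩ := this
  exact ⟨C, hC, fun x => h x (mem_univ x)⟩

end Compare

/-! ### Volume growth -/

section Growth

/-- The Cauchy--Schwarz inequality for a function dominated by a geometric mean. -/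
theorem sq_integral_le {Ω : Type*} [MeasurableSpace Ω] {μ : Measure Ω} {x y b : Ω → ℝ}
    (hx : Integrable x μ) (hy : Integrable y μ) (hb : Integrable b μ) (hx0 : ∀ u, 0 ≤ x u)
    (hy0 : ∀ u, 0 ≤ y u) (h : ∀ u, b u ^ 2 ≤ x u * y u) :
    (∫ u, b u ∂μ) ^ 2 ≤ (∫ u, x u ∂μ) * ∫ u, y u ∂μ := by
  -- the discriminant of a nonnegative quadratic polynomial in `l` is nonpositive
  have hpt : ∀ l : ℝ, ∀ u, 0 ≤ l ^ 2 * x u - 2 * l * b u + y u := by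
    intro l u
    rcases (hx0 u).eq_or_lt with h0 | h0
    · have hb0 : b u = 0 := by
        have := h u
        rw [← h0, zero_mul] at this
        exact pow_eq_zero_iff (two_ne_zero) |>.1 (le_antisymm this (sq_nonneg _))
      rw [hb0, ← h0]; simpa using hy0 u
    · refine nonneg_of_mul_nonneg_right (a := x u) ?_ h0
      nlinarith [h u, sq_nonneg (l * x u - b u)]
  have hint : ∀ l : ℝ, 0 ≤ (∫ u, x u ∂μ) * (l * l) + (-2 * ∫ u, b u ∂μ) * l + ∫ u, y u ∂μ := by
    intro l
    have h1 := integral_nonneg (μ := μ) (f := fun u => l ^ 2 * x u - 2 * l * b u + y u) (hpt l)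
    rw [integral_add (f := fun u => l ^ 2 * x u - 2 * l * b u)
        ((hx.const_mul _).sub (hb.const_mul _)) hy,
      integral_sub (hx.const_mul _) (hb.const_mul _), integral_const_mul, integral_const_mul] at h1
    linarith
  have := discrim_le_zero hint
  rw [discrim] at this
  linarith

/-- A primitive `V` of a nonnegative function `G` with `V ≤ K G` eventually grows at least like
`exp (t / K)`, which bounds the upper limit below. -/
theorem exists_limsup_lt_top {G : ℝ → ℝ} (hG : Continuous G) (hG0 : ∀ s, 0 ≤ s → 0 ≤ G s)
    {V : ℝ → ℝ} (hV : ∀ t, 0 ≤ t → V t = ∫ s in (0 : ℝ)..t, G s) {K r₀ : ℝ} (hK : 0 < K)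
    (h : ∀ t > r₀, V t ≤ K * G t) {t₁ : ℝ} (ht₁ : 0 < t₁) (hV₁ : 0 < V t₁) :
    limsup (fun b : ℝ => ((b / K - Real.log (∫ t in (0 : ℝ)..b, V t) : ℝ) : EReal)) atTop < ⊤ := by
  set P : ℝ → ℝ := fun t => ∫ s in (0 : ℝ)..t, G s with hP
  have hPd : ∀ s, HasDerivAt P (G s) s := fun s =>
    intervalIntegral.integral_hasDerivAt_right (hG.intervalIntegrable _ _)
      (hG.stronglyMeasurableAtFilter _ _) hG.continuousAt
  have hPc : Continuous P := continuous_iff_continuousAt.2 fun s => (hPd s).continuousAt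
  have hPm : MonotoneOn P (Ici 0) := by
    refine monotoneOn_of_deriv_nonneg (convex_Ici 0) hPc.continuousOn
      (fun s _ => (hPd s).differentiableAt.differentiableWithinAt) fun s hs => ?_
    rw [interior_Ici] at hs
    rw [(hPd s).deriv]
    exact hG0 s hs.le
  have hP0 : ∀ t, 0 ≤ t → 0 ≤ P t := fun t ht => by
    have := hPm (mem_Ici.2 le_rfl) (mem_Ici.2 ht) ht
    rwa [show P 0 = 0 from intervalIntegral.integral_same] at this
  set t₂ := max t₁ (r₀ + 1) with ht₂
  have ht₂0 : 0 < t₂ := lt_max_of_lt_left ht₁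
  have ht₂r : r₀ < t₂ := (lt_add_one r₀).trans_le (le_max_right _ _)
  have hP₂ : 0 < P t₂ := by
    have := hPm (mem_Ici.2 ht₁.le) (mem_Ici.2 ht₂0.le) (le_max_left _ _)
    rw [hV t₁ ht₁.le] at hV₁
    exact hV₁.trans_le this
  have hexp : ∀ t, t₂ ≤ t → P t₂ * Real.exp ((t - t₂) / K) ≤ P t := by
    have hd : ∀ s, HasDerivAt (fun s => P s * Real.exp (-(s / K)))
        (G s * Real.exp (-(s / K)) + P s * (Real.exp (-(s / K)) * (-(1 / K)))) s := fun s =>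
      (hPd s).mul (((hasDerivAt_id s).div_const K).neg.exp)
    have hm : MonotoneOn (fun s => P s * Real.exp (-(s / K))) (Ici t₂) := by
      refine monotoneOn_of_deriv_nonneg (convex_Ici _)
        (fun s _ => (hd s).continuousAt.continuousWithinAt)
        (fun s _ => (hd s).differentiableAt.differentiableWithinAt) fun s hs => ?_
      rw [interior_Ici] at hs
      rw [(hd s).deriv]
      have h1 := h s (ht₂r.trans hs)
      rw [hV s (ht₂0.trans hs).le] at h1
      have h2 : P s * (1 / K) ≤ G s := by
        rw [mul_one_div, div_le_iff₀ hK]; linarith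
      have h3 := mul_le_mul_of_nonneg_right h2 (Real.exp_pos (-(s / K))).le
      linarith
    intro t ht
    have h1 := hm (mem_Ici.2 le_rfl) (mem_Ici.2 ht) ht
    have h2 : Real.exp ((t - t₂) / K) = Real.exp (-(t₂ / K)) * Real.exp (t / K) := by
      rw [← Real.exp_add]; congr 1; ring
    have h3 := mul_le_mul_of_nonneg_right h1 (Real.exp_pos (t / K)).le
    simp only [mul_assoc] at h3
    rw [← Real.exp_add (-(t / K)), neg_add_cancel, Real.exp_zero, mul_one] at h3
    rw [h2]
    exact h3
  set M := P t₂ * Real.exp (-(1 + t₂) / K) with hM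
  have hM0 : 0 < M := by positivity
  have hev : ∀ b, t₂ + 1 ≤ b → b / K - Real.log (∫ t in (0 : ℝ)..b, V t) ≤ -Real.log M := by
    intro b hb
    have hb0 : 0 ≤ b := by linarith
    have e1 : ∫ t in (0 : ℝ)..b, V t = ∫ t in (0 : ℝ)..b, P t := by
      refine intervalIntegral.integral_congr fun t ht => ?_
      rw [uIcc_of_le hb0] at ht
      exact hV t ht.1
    have e2 : (∫ t in (b - 1)..b, P t) ≤ ∫ t in (0 : ℝ)..b, P t := by
      rw [← intervalIntegral.integral_add_adjacent_intervals (a := 0) (b := b - 1)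
        (hPc.intervalIntegrable _ _) (hPc.intervalIntegrable _ _)]
      refine le_add_of_nonneg_left (intervalIntegral.integral_nonneg (by linarith) fun t ht => ?_)
      exact hP0 t ht.1
    have e3 : P (b - 1) ≤ ∫ t in (b - 1)..b, P t := by
      have := intervalIntegral.integral_mono_on (a := b - 1) (b := b) (μ := volume)
        (f := fun _ => P (b - 1)) (g := P) (by linarith)
        (continuous_const.intervalIntegrable _ _) (hPc.intervalIntegrable _ _) fun t ht =>
          hPm (mem_Ici.2 (by linarith)) (mem_Ici.2 (by linarith [ht.1])) ht.1
      simpa using this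
    have e4 : M * Real.exp (b / K) ≤ P (b - 1) := by
      refine le_trans (le_of_eq ?_) (hexp (b - 1) (by linarith))
      rw [hM, mul_assoc, ← Real.exp_add]
      congr 2; ring
    have e5 : M * Real.exp (b / K) ≤ ∫ t in (0 : ℝ)..b, V t := by
      rw [e1]; exact e4.trans (e3.trans e2)
    have e6 := Real.log_le_log (by positivity) e5
    rw [Real.log_mul hM0.ne' (Real.exp_pos _).ne', Real.log_exp] at e6
    linarith
  refine lt_of_le_of_lt (b := ((-Real.log M : ℝ) : EReal)) ?_ (EReal.coe_lt_top _)
  refine limsup_le_of_le (h := ?_)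
  filter_upwards [eventually_ge_atTop (t₂ + 1)] with b hb
  exact EReal.coe_le_coe_iff.2 (hev b hb)

end Growth

section AreaIntegrable

variable {q : ℕ}

theorem exists_forall_abs_le {Ω ι : Type*} [TopologicalSpace Ω] [CompactSpace Ω] [Fintype ι]
    {g : ι → Ω → ℝ} (hg : ∀ i, Continuous (g i)) : ∃ M, 0 ≤ M ∧ ∀ i u, |g i u| ≤ M := by
  obtain ⟨M, hM⟩ := isCompact_univ.exists_bound_of_continuousOn
    (continuous_pi hg : Continuous fun u i => g i u).continuousOn
  refine ⟨max M 0, le_max_right _ _, fun i u => ?_⟩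
  exact ((norm_le_pi_norm (fun i => g i u) i).trans (hM u (mem_univ u))).trans (le_max_left _ _)

/-- The density of the weighted area is integrable over spheres, being measurable and bounded. In
particular `weightedArea` is not a junk value. -/
theorem integrable_areaDensity (hq : 1 ≤ q) {k : DiffForm (Cn q) (Cn q) 2} (hk : Continuous k)
    (ha : ∀ z, IsSemiposForm (k z)) {t : ℝ} (ht : 0 < t) :
    Integrable (fun u : Metric.sphere (0 : Cn q) 1 =>
      areaDensity hq (k (t • (u : Cn q))) (t • (u : Cn q)))
      (volume : Measure (Cn q)).toSphere := by
  have hz0 : ∀ u : Metric.sphere (0 : Cn q) 1, t • (u : Cn q) ≠ 0 := fun u =>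
    smul_ne_zero ht.ne' (ne_zero_of_mem_unit_sphere u)
  have hz : Continuous fun u : Metric.sphere (0 : Cn q) 1 => t • (u : Cn q) := by fun_prop
  obtain ⟨M₁, hM₁, h₁⟩ := exists_forall_abs_le
    (g := fun (i : Fin (2 * q - 1 + 1) × Fin (2 * q - 1 + 1)) (u : Metric.sphere (0 : Cn q) 1) =>
      k (t • (u : Cn q)) ![stdFrame q i.1, stdFrame q i.2])
    (fun i => continuous_stdForm (hk.comp hz) _ _)
  obtain ⟨M₂, hM₂, h₂⟩ := exists_forall_abs_le
    (g := fun (i : Fin (2 * q - 1 + 1)) (u : Metric.sphere (0 : Cn q) 1) =>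
      dtau (t • (u : Cn q)) (Complex.I • stdFrame q i))
    (fun i => (continuous_dtau.comp hz).clm_apply continuous_const)
  obtain ⟨M₃, hM₃, h₃⟩ := exists_forall_abs_le
    (g := fun (i : Fin (2 * q - 1 + 1)) (u : Metric.sphere (0 : Cn q) 1) =>
      dr (t • (u : Cn q)) (stdFrame q i))
    (fun i => by
      simp only [dr_apply_smul ht]
      exact continuous_subtype_val.inner continuous_const)
  set M := M₁ + M₂ + M₃
  have hbound : ∀ u : Metric.sphere (0 : Cn q) 1,
      areaDensity hq (k (t • (u : Cn q))) (t • (u : Cn q)) ≤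
        (2 * q - 1 + 1 : ℕ) * (M * ((2 * q - 1 + 1 : ℕ).factorial * M ^ q)) := fun u =>
    areaDensity_le (ha _) hq (hz0 u) (by positivity)
      (fun i j => (h₁ (i, j) u).trans (by linarith)) (fun i => (h₂ i u).trans (by linarith))
      (fun i => (h₃ i u).trans (by linarith))
  refine Integrable.of_bound
    (measurable_areaDensity hq (hk.comp hz) (fun u => ha _) hz hz0).aestronglyMeasurable
    ((2 * q - 1 + 1 : ℕ) * (M * ((2 * q - 1 + 1 : ℕ).factorial * M ^ q)))
    (Eventually.of_forall fun u => ?_)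
  rw [Real.norm_of_nonneg (areaDensity_nonneg (ha _) hq (hz0 u))]
  exact hbound u

end AreaIntegrable

section Core

theorem integrable_sphere {g : Metric.sphere (0 : Cn p) 1 → ℝ} (hg : Continuous g) :
    Integrable g (volume : Measure (Cn p)).toSphere := by
  have h3 := hg.continuousOn.integrableOn_compact
    (μ := (volume : Measure (Cn p)).toSphere) isCompact_univ
  simpa using h3

/-- The differential inequality for the volume. Here `k` is a (degenerate) metric on `ℂ^p`, and
`β` is a `k`-bounded primitive of a volume form with density `D` that dominates the volume form
of `k`. Stokes' theorem bounds the volume of the ball by an integral over the sphere, and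
Cauchy--Schwarz bounds this integral by the weighted area and the derivative of the volume. -/
theorem volume_le_deriv (hp : 1 ≤ p) {k : DiffForm (Cn p) (Cn p) 2} (hk : Continuous k)
    (ha : ∀ z, IsSemiposForm (k z)) {β : DiffForm (Cn p) (Cn p) (2 * p - 1)}
    (hβ : ∀ v, ContDiff ℝ 1 fun z => β z v) (hβ' : Differentiable ℝ β)
    {C : ℝ} (hβC : ∀ z v, |β z v| ≤ C * ∏ j, √(quad (k z) (v j)))
    {D : Cn p → ℝ} (hD : Continuous D) (hβD : ∀ z, extDeriv β z (stdFrame p) = D z)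
    {c : ℝ} (hkD : ∀ z, volDensity p hp (k z) ≤ c * D z)
    {C₁ t : ℝ} (hC₁ : 0 ≤ C₁) (ht : 0 < t)
    (harea : sphereIntegral t (fun z => covecNorm (k z) (dtau z) • areaForm hp k z) ≤
      C₁ * t * ∫ z in Metric.ball (0 : Cn p) t, volDensity p hp (k z)) :
    ∫ z in Metric.ball (0 : Cn p) t, volDensity p hp (k z) ≤
      (c ^ 2 * ((2 * p - 1 + 1 : ℕ) * C * topConst p) ^ 2 * C₁ + 1) *
        (t ^ (2 * p - 1) * sphereMean volume (fun z => volDensity p hp (k z)) t) := by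
  set κ := ((2 * p - 1 + 1 : ℕ) * C * topConst p) ^ 2 with hκ
  have hz0 : ∀ u : Metric.sphere (0 : Cn p) 1, t • (u : Cn p) ≠ 0 := fun u =>
    smul_ne_zero ht.ne' (ne_zero_of_mem_unit_sphere u)
  have hzn : ∀ u : Metric.sphere (0 : Cn p) 1, ‖t • (u : Cn p)‖ = t := fun u => by
    rw [norm_smul, norm_eq_of_mem_sphere, mul_one, Real.norm_of_nonneg ht.le]
  have hz : Continuous fun u : Metric.sphere (0 : Cn p) 1 => t • (u : Cn p) := by fun_prop
  have hvc := continuous_volDensity hp hk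
  have hball : ∀ {g : Cn p → ℝ}, Continuous g → IntegrableOn g (Metric.ball 0 t) := fun hg =>
    (hg.continuousOn.integrableOn_compact (isCompact_closedBall (0 : Cn p) t)).mono_set
      Metric.ball_subset_closedBall
  set a : Metric.sphere (0 : Cn p) 1 → ℝ := fun u =>
    areaDensity hp (k (t • (u : Cn p))) (t • (u : Cn p)) with hadef
  set b : Metric.sphere (0 : Cn p) 1 → ℝ := fun u =>
    covecWedge (dr (t • (u : Cn p))) (β (t • (u : Cn p))) (stdFrame p) with hbdef
  set d : Metric.sphere (0 : Cn p) 1 → ℝ := fun u => volDensity p hp (k (t • (u : Cn p))) with hd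
  set σ := (volume : Measure (Cn p)).toSphere
  have ha0 : ∀ u, 0 ≤ a u := fun u => areaDensity_nonneg (ha _) hp (hz0 u)
  have hd0 : ∀ u, 0 ≤ d u := fun u => volDensity_nonneg (ha _) hp
  have hai : Integrable a σ := integrable_areaDensity hp hk ha ht
  have hdi : Integrable d σ := integrable_sphere (hvc.comp hz)
  have hbi : Integrable b σ := by
    refine integrable_sphere ?_
    simp only [hbdef, covecWedge_apply, dr_apply_smul ht]
    exact continuous_finsetSum _ fun i _ => continuous_const.mul
      ((continuous_subtype_val.inner continuous_const).mul ((hβ _).continuous.comp hz))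
  have hCS : (∫ u, b u ∂σ) ^ 2 ≤ (κ * (2 * t)⁻¹ * ∫ u, a u ∂σ) * ∫ u, d u ∂σ := by
    rw [← integral_const_mul (κ * (2 * t)⁻¹) a]
    refine sq_integral_le (hai.const_mul _) hdi hbi
      (fun u => mul_nonneg (by positivity) (ha0 u)) hd0 fun u => ?_
    have := sq_covecWedge_le (ha (t • (u : Cn p))) hp (hz0 u) (β (t • (u : Cn p))) (hβC _)
    rw [hzn] at this
    rw [mul_assoc]
    exact this
  set v := ∫ z in Metric.ball (0 : Cn p) t, volDensity p hp (k z) with hv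
  have hv0 : 0 ≤ v := integral_nonneg fun z => volDensity_nonneg (ha z) hp
  have hstokes : v ≤ c * (t ^ (2 * p - 1) * ∫ u, b u ∂σ) := by
    have h1 := ballIntegral_extDeriv hp hβ hβ' ht
    rw [sphereIntegral, ballIntegral] at h1
    simp only [hβD] at h1
    have h2 : ∫ z in Metric.ball (0 : Cn p) t, D z = t ^ (2 * p - 1) * ∫ u, b u ∂σ := h1
    rw [← h2, ← integral_const_mul]
    exact setIntegral_mono (hball hvc) (hball (continuous_const.mul hD)) hkD
  have harea' : t ^ (2 * p - 1) * ∫ u, a u ∂σ ≤ C₁ * t * v := harea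
  set G := t ^ (2 * p - 1) * sphereMean volume (fun z => volDensity p hp (k z)) t with hG
  have hGd : G = t ^ (2 * p - 1) * ∫ u, d u ∂σ := rfl
  have hd0' : 0 ≤ ∫ u, d u ∂σ := integral_nonneg hd0
  have hG0 : 0 ≤ G := by rw [hGd]; positivity
  have hmain : v * v ≤ v * ((c ^ 2 * κ * C₁) * G) := by
    calc v * v ≤ (c * (t ^ (2 * p - 1) * ∫ u, b u ∂σ)) ^ 2 := by
          rw [← sq]; exact pow_le_pow_left₀ hv0 hstokes 2
      _ = c ^ 2 * (t ^ (2 * p - 1)) ^ 2 * (∫ u, b u ∂σ) ^ 2 := by ring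
      _ ≤ c ^ 2 * (t ^ (2 * p - 1)) ^ 2 * ((κ * (2 * t)⁻¹ * ∫ u, a u ∂σ) * ∫ u, d u ∂σ) :=
          mul_le_mul_of_nonneg_left hCS (by positivity)
      _ = c ^ 2 * κ * (2 * t)⁻¹ * G * (t ^ (2 * p - 1) * ∫ u, a u ∂σ) := by rw [hGd]; ring
      _ ≤ c ^ 2 * κ * (2 * t)⁻¹ * G * (C₁ * t * v) :=
          mul_le_mul_of_nonneg_left harea' (by positivity)
      _ = (1 / 2) * (v * ((c ^ 2 * κ * C₁) * G)) := by field_simp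
      _ ≤ 1 * (v * ((c ^ 2 * κ * C₁) * G)) :=
          mul_le_mul_of_nonneg_right (by norm_num) (by positivity)
      _ = _ := one_mul _
  rcases hv0.eq_or_lt with h0 | h0
  · rw [← h0]; positivity
  · have := le_of_mul_le_mul_left hmain h0
    linarith

end Core

end PartialHyp

end

theorem theorem2p7 (n p r : ℕ) (hp : 1 ≤ p) (hpn : p < n) (hr : p ≤ r)
    (X : Type u) [TopologicalSpace X] [T2Space X] [CompactSpace X] [ConnectedSpace X]
    [ChartedSpace (EuclideanSpace ℂ (Fin n)) X]
    [IsManifold (modelWithCornersSelf ℂ (EuclideanSpace ℂ (Fin n))) ω X]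
    (E : PartialHyp.SmoothSubbundle (EuclideanSpace ℂ (Fin n)) X r)
    (hE : PartialHyp.IsPartiallyKahlerHyperbolic E p hp) :
    PartialHyp.IsPartiallyHyperbolic E p hp := by
  open PartialHyp in
  obtain ⟨γE, γN, hγE, hγN, hω, -, hherm, -, Y, _, _, _, π, hπ, Γ, hΓs, ⟨C, hΓb⟩, hΓd⟩ := hE
  rintro ⟨f, hf, hhor, ⟨z₀, hz₀⟩, γ, hγ, ⟨⟨C₁, hC₁, r₀, hr₀, harea⟩, hlimsup⟩⟩
  obtain ⟨F, hF, hFf⟩ := exists_holomorphic_lift hπ hf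
  have hfm := hf.mdifferentiable (n := ω) (by simp)
  have hFm := hF.mdifferentiable (n := ω) (by simp)
  have hπm := hπ.localBiholomorphic.mdifferentiable (n := ω) (by simp)
  obtain ⟨A, hA, hωγ⟩ := exists_quad_le hγ hω
  obtain ⟨B, hB, hγω⟩ := exists_quad_le hω hγ
  set k : DiffForm (Cn p) (Cn p) 2 := pullback f γ with hk
  set h : DiffForm (Cn p) (Cn p) 2 := pullback f (γE + γN) with hh
  have hka : ∀ z, IsSemiposForm (k z) := fun z => (hγ.isSemiposForm _).comp _
  have hha : ∀ z, IsSemiposForm (h z) := fun z => (hω.isSemiposForm _).comp _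
  have hkc : Continuous k := continuous_pullback hf hγ.smooth
  have hhc : Continuous h := continuous_pullback hf hω.smooth
  -- `f` is horizontal, so the component `γN` does not contribute to the pullback
  have hhE : ∀ z, h z = pullback f γE z := by
    intro z
    have h0 : ∀ u v : Cn p, γN (f z) ![(diff f z : Cn p →L[ℂ] _) u,
        (diff f z : Cn p →L[ℂ] _) v] = 0 := by
      intro u v
      have := congrArg Complex.im (hherm (f z) _ (hhor z u) _ (hhor z v))
      simpa [herm] using this
    ext v
    have h1 : (fun i => (diff f z : Cn p →L[ℂ] EuclideanSpace ℂ (Fin n)) (v i)) =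
        ![(diff f z : Cn p →L[ℂ] _) (v 0), (diff f z : Cn p →L[ℂ] _) (v 1)] := by
      ext1 i; fin_cases i <;> rfl
    rw [hh, pullback_apply, pullback_apply, Pi.add_apply, ContinuousAlternatingMap.add_apply, h1,
      h0, add_zero]
  set β : DiffForm (Cn p) (Cn p) (2 * p - 1) := pullback F Γ with hβ
  have hquad : ∀ z u, quad (h z) u ≤ A * quad (k z) u := by
    intro z u
    rw [hh, hk, quad_pullback, quad_pullback]
    exact hωγ _ _
  have hquad' : ∀ z u, quad (k z) u ≤ B * quad (h z) u := by
    intro z u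
    rw [hh, hk, quad_pullback, quad_pullback]
    exact hγω _ _
  have hβC : ∀ z v, |β z v| ≤ (|C| * √A ^ (2 * p - 1)) * ∏ j, √(quad (k z) (v j)) := by
    intro z v
    have h1 := hΓb (F z) fun i => (diff F z : Cn p →L[ℂ] EuclideanSpace ℂ (Fin n)) (v i)
    have h2 : ∀ j, quad ((pullback π (γE + γN) : DiffForm _ Y 2) (F z))
        ((diff F z : Cn p →L[ℂ] EuclideanSpace ℂ (Fin n)) (v j)) = quad (h z) (v j) := by
      intro j
      rw [← quad_pullback, ← pullback_comp _ (hπm _) (hFm _), hFf]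
    simp only [h2] at h1
    refine h1.trans ?_
    rw [mul_assoc]
    refine mul_le_mul (le_abs_self C) ?_ (by positivity) (abs_nonneg C)
    calc ∏ j, √(quad (h z) (v j)) ≤ ∏ j, √A * √(quad (k z) (v j)) := by
          refine Finset.prod_le_prod (fun _ _ => Real.sqrt_nonneg _) fun j _ => ?_
          rw [← Real.sqrt_mul hA]
          exact Real.sqrt_le_sqrt (hquad _ _)
      _ = _ := by rw [Finset.prod_mul_distrib]; simp
  have hβD : ∀ z, extDeriv β z (stdFrame p) = volDensity p hp (h z) := by
    intro z
    have h1 : (pullback π (formPow γE p hp) : DiffForm _ Y _) = extD Γ := funext hΓd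
    rw [hβ, ← pullback_extD hF hΓs, ← h1, ← pullback_comp _ (hπm _) (hFm _), hFf, hhE]
    exact congrArg (fun β => β (stdFrame p)) (divPow_comp (γE (f z)) _ _ _ _).symm
  have hvol : ∀ t, volBall hp γ f t =
      ∫ z in Metric.ball (0 : Cn p) t, volDensity p hp (k z) := by
    intro t
    refine integral_congr_ae (Eventually.of_forall fun z => ?_)
    exact congrArg (fun β => β (stdFrame p)) (divPow_comp (γ (f z)) _ _ _ _).symm
  have hkvc := continuous_volDensity hp hkc
  set K := ((2 * p - 1 + 1).factorial * √B ^ (2 * p - 1 + 1) * topConst p) ^ 2 *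
    ((2 * p - 1 + 1 : ℕ) * (|C| * √A ^ (2 * p - 1)) * topConst p) ^ 2 * C₁ + 1 with hK
  have hK0 : 0 < K := by positivity
  have hnt : Nontrivial (Cn p) := by
    have : Nonempty (Fin p) := ⟨⟨0, hp⟩⟩
    infer_instance
  have hineq : ∀ t > r₀, volBall hp γ f t ≤
      K * (t ^ (2 * p - 1) * sphereMean volume (fun z => volDensity p hp (k z)) t) := by
    intro t ht
    have h1 := harea t ht
    rw [hvol] at h1 ⊢
    exact volume_le_deriv hp hkc hka (contDiff_pullback_apply hF hΓs)
      (differentiable_pullback hF hΓs) hβC (continuous_volDensity hp hhc) hβD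
      (fun z => volDensity_le_of_quad_le (hha z) (hka z) hp hB (hquad' z)) hC₁.le
      (hr₀.trans ht) h1
  -- positivity of the volume comes from the point where `f` is nondegenerate
  have hz₀D : 0 < volDensity p hp (k z₀) := by
    refine volDensity_pos (hka z₀) hp fun u hu => ?_
    rw [hk, quad_pullback]
    exact hγ.pos _ _ fun h0 => hu (hz₀ (h0.trans (map_zero _).symm))
  have ht₁ : 0 < volBall hp γ f (‖z₀‖ + 1) := by
    rw [hvol, setIntegral_pos_iff_support_of_nonneg_ae
      (Eventually.of_forall fun z => volDensity_nonneg (hka z) hp)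
      ((hkvc.continuousOn.integrableOn_compact (isCompact_closedBall (0 : Cn p) _)).mono_set
        Metric.ball_subset_closedBall)]
    refine (hkvc.isOpen_support.inter Metric.isOpen_ball).measure_pos _ ⟨z₀, hz₀D.ne', ?_⟩
    rw [mem_ball_zero_iff]; linarith
  have hfin := exists_limsup_lt_top
    (G := fun t => t ^ (2 * p - 1) * sphereMean volume (fun z => volDensity p hp (k z)) t)
    ((continuous_pow _).mul (continuous_sphereMean volume hkvc))
    (fun s hs => mul_nonneg (pow_nonneg hs _)
      (integral_nonneg fun u => volDensity_nonneg (hka _) hp))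
    (V := fun t => volBall hp γ f t)
    (fun t ht => by
      rw [hvol, integral_ball_polar volume hkvc ht, finrank_real_Cn]) hK0 hineq
    (by positivity) ht₁
  exact hfin.ne (hlimsup K hK0)
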